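/- Let $d \ge 0$ be an integer and let $S \subset \mathbb{R}^d$ be nonempty, open and periodic, i.e. there is a basis $b_1,\dots,b_d$ of $\mathbb{R}^d$ with $S + b_j = S$ for all $j$. Let $T > 0$. Then the controlled Schrödinger equation $$ i \,\partial_t u + \Delta u = \mathbf{1}_S f \quad \text{in } \mathbb{R}^d \times [0,T], \qquad u(0) = u_0, $$ is exactly controllable in time $T$: for all $u_0, u_T \in L^2(\mathbb{R}^d)$ there is a control $f \in L^2(S \times (0,T))$ such that the mild solution, given for $t \in [0,T]$ by the Duhamel formula $$ u(t) = \mathrm{e}^{it\Delta} u_0 - i \int_0^t \mathrm{e}^{i(t-s)\Delta}\, \mathbf{1}_S f(s) \,\mathrm{d}s $$ (where the integrand is Bochner integrable in $L^2(\mathbb{R}^d)$), satisfies $u(T) = u_T$. In particular it is null-controllable in time $T$: for every $u_0 \in L^2(\mathbb{R}^d)$ there is $f \in L^2(S \times (0,T))$ with $u(T) = 0$. -/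

import Mathlib

open MeasureTheory FourierTransform

noncomputable section

namespace SchrodingerControl

/-- Euclidean space `ℝ^d`. -/
abbrev Space (d : ℕ) : Type := EuclideanSpace ℝ (Fin d)

/-- The Hilbert space `L²(ℝ^d)` of (classes of) complex-valued functions. -/
abbrev L2 (d : ℕ) : Type := Lp (α := Space d) ℂ 2 volume

/-- The space of controls `L²(S × (0,T))`. -/
abbrev Control {d : ℕ} (S : Set (Space d)) (T : ℝ) : Type :=
  Lp (α := Space d × ℝ) ℂ 2 (volume.restrict (S ×ˢ Set.Ioo (0 : ℝ) T))

/-- A set is periodic if it is invariant under the translations by the vectors of some basis of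
`ℝ^d`, that is, under the full-rank lattice spanned by that basis. -/
def IsPeriodicSet {d : ℕ} (S : Set (Space d)) : Prop :=
  ∃ b : Module.Basis (Fin d) ℝ (Space d), ∀ (i : Fin d) (x : Space d), x + b i ∈ S ↔ x ∈ S

/-- The Fourier symbol of `exp (i t Δ)`. Mathlib's Fourier transform has the kernel
`exp (-2 π i ⟪x, ξ⟫)`, so that `Δ` has the symbol `-4 π² |ξ|²`. -/
def schrodingerSymbol {d : ℕ} (t : ℝ) (ξ : Space d) : ℂ :=
  Complex.exp (-(Complex.I * ((t * (4 * Real.pi ^ 2 * ‖ξ‖ ^ 2) : ℝ) : ℂ)))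

theorem norm_schrodingerSymbol {d : ℕ} (t : ℝ) (ξ : Space d) :
    ‖schrodingerSymbol t ξ‖ = 1 := by
  rw [schrodingerSymbol, Complex.norm_exp, Complex.neg_re, Complex.I_mul_re, Complex.ofReal_im]
  simp

theorem continuous_schrodingerSymbol {d : ℕ} (t : ℝ) :
    Continuous (schrodingerSymbol (d := d) t) := by
  unfold schrodingerSymbol
  fun_prop

theorem memLp_schrodingerSymbol_mul {d : ℕ} (t : ℝ) (v : L2 d) :
    MemLp (fun ξ => schrodingerSymbol t ξ * v ξ) 2 volume := by
  refine (Lp.memLp v).of_le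
    ((continuous_schrodingerSymbol t).aestronglyMeasurable.mul (Lp.aestronglyMeasurable v)) ?_
  filter_upwards with ξ
  rw [norm_mul, norm_schrodingerSymbol, one_mul]

/-- The free Schrödinger group `exp (i t Δ)` on `L²(ℝ^d)`, as a Fourier multiplier. -/
def schrodingerGroup {d : ℕ} (t : ℝ) (u : L2 d) : L2 d :=
  𝓕⁻ ((memLp_schrodingerSymbol_mul t (𝓕 u)).toLp _ : L2 d)

open Classical in
/-- The time slice `1_S f(s)` of a control `f`, extended by zero to an element of `L²(ℝ^d)`.
By Fubini's theorem the first case occurs for almost every `s` in `(0,T)`. -/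
def controlSlice {d : ℕ} {S : Set (Space d)} {T : ℝ} (f : Control S T) (s : ℝ) : L2 d :=
  if h : MemLp (S.indicator fun x => f (x, s)) 2 volume then h.toLp _ else 0

/-- `u` is the (mild) solution on `[0,T]` of `i u_t + Δ u = 1_S f`, `u(0) = u₀`. As the equation
reads `u_t = i Δ u - i 1_S f`, the Duhamel formula is
`u(t) = exp (i t Δ) u₀ - i ∫₀ᵗ exp (i (t - s) Δ) 1_S f(s) ds`, with a Bochner integral. -/
structure IsSolution {d : ℕ} {S : Set (Space d)} {T : ℝ} (u₀ : L2 d) (f : Control S T)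
    (u : ℝ → L2 d) : Prop where
  intervalIntegrable : ∀ t ∈ Set.Icc (0 : ℝ) T,
    IntervalIntegrable (fun s => schrodingerGroup (t - s) (controlSlice f s)) volume 0 t
  duhamel : ∀ t ∈ Set.Icc (0 : ℝ) T,
    u t = schrodingerGroup t u₀
      - Complex.I • ∫ s in (0 : ℝ)..t, schrodingerGroup (t - s) (controlSlice f s)

/-- (Exact) controllability in time `T` of the Schrödinger equation controlled from `S`. -/
def Controllable {d : ℕ} (S : Set (Space d)) (T : ℝ) : Prop :=
  ∀ u₀ u₁ : L2 d, ∃ (f : Control S T) (u : ℝ → L2 d), IsSolution u₀ f u ∧ u T = u₁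

/-- Null-controllability in time `T` of the Schrödinger equation controlled from `S`. -/
def NullControllable {d : ℕ} (S : Set (Space d)) (T : ℝ) : Prop :=
  ∀ u₀ : L2 d, ∃ (f : Control S T) (u : ℝ → L2 d), IsSolution u₀ f u ∧ u T = 0

end SchrodingerControl

end

/-!
The proof is by duality. Up to a unitary factor, the state reached from zero with the control `f` is
`Ψ f = ∫₀ᵀ exp (-i s Δ) 1_S f(s) ds` (`controlMap`), and the adjoint of `Ψ` sends `v` to the
restriction of the free wave `exp (i t Δ) v` to `S × (0,T)`. Hence `Ψ` is onto as soon as the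
observability inequality `‖v‖² ≤ C ∫₀ᵀ ∫_S |exp (i t Δ) v|²` holds, for then `Ψ Ψ†` is coercive
(`surjective_controlMap`). By density it suffices to consider `v` whose Fourier transform is smooth
and compactly supported, so that the free wave is an absolutely convergent integral of plane waves.

Let `L` be the lattice dual to the lattice of periods. Grouping the frequencies of the free wave by
their class modulo `L` (Floquet's decomposition) writes it as a superposition of fibres, which are
finite sums of plane waves with frequencies `(ξ, -2π|ξ|²)`, `ξ` in a coset of `L`. The values of the
free wave at the translates of a point by the periods are the Fourier coefficients of its fibres at
this point (`freeWave_add_period`). So by Parseval's identity, integrating the free wave over all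
the translates of one small space-time ball contained in `S × (0,T)` amounts to integrating every
fibre over that ball. Observability thus reduces to a bound
`∑ |c_l|² ≤ C ∫_B |∑ c_l e_l|²` for sums of waves on an arbitrarily small ball `B` of space-time,
uniformly over the cosets of `L` (`exists_sum_le_integral_waveSum`).

This bound is obtained from two principles. Ingham's inequality (`exists_obs_of_isSep`) gives it
for very sparse frequencies. Kahane's gluing theorem (`UnifObs.union`) gives it for the union of two
sets of frequencies that have it, provided the union is separated, on any ball whose radius exceeds
the sum of the two radii; as the radii are arbitrary, finitely many gluings are harmless.
To exploit these on the paraboloid, consider points over a strip in which the inner products with a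
finite set `A` of vectors vary boundedly. If two such points are congruent modulo the span of `A`,
their difference is one of finitely many lattice vectors, so the points fall into finitely many
families in which no two points are congruent. In such a family, if the points over `ξ` and `ξ + m`
are close, then `m` is one of finitely many vectors outside the span of `A`, and since
`|ξ + m|² - |ξ|²` is bounded, `ξ` has a bounded inner product with `m`. Removing these finitely many
strips, which are associated with the larger sets `A ∪ {m}`, leaves a sparse set, and an induction
on the codimension of the span of `A` concludes (`unifObs_of_transversal`, `unifObs_of_inStrip`).
-/

open MeasureTheory FourierTransform

noncomputable section

namespace SchrodingerControl

/-! ### Plane waves and bump functions on space-time -/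

/-- Space-time `ℝ^d × ℝ`, with the sup norm; its dual is identified with it, see `wave`. -/
abbrev SpaceTime (d : ℕ) : Type := Space d × ℝ

variable {d : ℕ}

/-- The plane wave of frequency `l` at the space-time point `z`. -/
def wave (l z : SpaceTime d) : ℂ :=
  Complex.exp (((2 * Real.pi * (inner ℝ l.1 z.1 + l.2 * z.2) : ℝ) : ℂ) * Complex.I)

theorem wave_add_left (l m z : SpaceTime d) : wave (l + m) z = wave l z * wave m z := by
  simp only [wave, ← Complex.exp_add, Prod.fst_add, Prod.snd_add, inner_add_left]
  congr 1
  push_cast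
  ring

theorem wave_add_right (l z w : SpaceTime d) : wave l (z + w) = wave l z * wave l w := by
  simp only [wave, ← Complex.exp_add, Prod.fst_add, Prod.snd_add, inner_add_right]
  congr 1
  push_cast
  ring

@[simp]
theorem wave_zero_left (z : SpaceTime d) : wave 0 z = 1 := by simp [wave]

@[simp]
theorem norm_wave (l z : SpaceTime d) : ‖wave l z‖ = 1 := by
  rw [wave, Complex.norm_exp_ofReal_mul_I]

theorem wave_neg_left (l z : SpaceTime d) : wave (-l) z = starRingEnd ℂ (wave l z) := by
  rw [wave, wave, ← Complex.exp_conj]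
  congr 1
  rw [map_mul, Complex.conj_ofReal, Complex.conj_I]
  simp only [Prod.fst_neg, Prod.snd_neg, inner_neg_left]
  push_cast
  ring

theorem wave_sub_left (l m z : SpaceTime d) :
    wave (l - m) z = wave l z * starRingEnd ℂ (wave m z) := by
  rw [sub_eq_add_neg, wave_add_left, wave_neg_left]

theorem continuous_wave_right (l : SpaceTime d) : Continuous fun z => wave l z := by
  unfold wave
  fun_prop

theorem continuous_wave_left (z : SpaceTime d) : Continuous fun l => wave l z := by
  unfold wave
  fun_prop

/-- The Fourier coefficient of a weight `φ` at the frequency `l`, with the sign of `wave`. -/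
def waveCoeff (φ : SpaceTime d → ℝ) (l : SpaceTime d) : ℂ := ∫ z, (φ z : ℂ) * wave l z

/-- Normalised nonnegative bump functions of radius `ε`, with a decay of the Fourier transform
which is summable over separated sets, with one power to spare. -/
structure IsBump (ε : ℝ) (φ : SpaceTime d → ℝ) : Prop where
  continuous : Continuous φ
  nonneg : ∀ z, 0 ≤ φ z
  support : Function.support φ = Metric.ball 0 ε
  integral : ∫ z, φ z = 1
  decay : ∃ C : ℝ, ∀ l, ‖waveCoeff φ l‖ ≤ C * ((1 + ‖l‖) ^ (d + 3))⁻¹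

/-- The inverse Fourier transform of a test function decays rapidly, being a Schwartz function. -/
theorem exists_decay_fourierInv {V : Type*} [NormedAddCommGroup V] [InnerProductSpace ℝ V]
    [FiniteDimensional ℝ V] [MeasurableSpace V] [BorelSpace V] (f : V → ℝ)
    (hf : HasCompactSupport f) (hf' : ContDiff ℝ (⊤ : ℕ∞) f) (k : ℕ) :
    ∃ C : ℝ, ∀ w : V, (1 + ‖w‖) ^ k *
      ‖∫ v, Complex.exp ((2 * Real.pi * inner ℝ v w : ℝ) * Complex.I) * (f v : ℂ)‖ ≤ C := by
  have h1 : HasCompactSupport fun v => (f v : ℂ) := hf.comp_left Complex.ofReal_zero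
  have h2 : ContDiff ℝ (⊤ : ℕ∞) fun v => (f v : ℂ) := Complex.ofRealCLM.contDiff.comp hf'
  have key := fun w : V => SchwartzMap.one_add_le_sup_seminorm_apply (𝕜 := ℝ) (m := (k, 0))
    (le_refl k) (le_refl 0) (𝓕⁻ (h1.toSchwartzMap h2)) w
  refine ⟨2 ^ k * (Finset.Iic (k, 0)).sup (fun m => SchwartzMap.seminorm ℝ m.1 m.2)
    (𝓕⁻ (h1.toSchwartzMap h2)), fun w => ?_⟩
  have h3 := key w
  rw [norm_iteratedFDeriv_zero, SchwartzMap.fourierInv_coe, Real.fourierInv_eq'] at h3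
  exact h3

/-- A product of smooth bumps in space and in time, whose Fourier transform is a product as well. -/
theorem exists_isBump {ε : ℝ} (hε : 0 < ε) : ∃ φ : SpaceTime d → ℝ, IsBump ε φ := by
  let f1 : ContDiffBump (0 : Space d) := ⟨ε / 2, ε, by linarith, by linarith⟩
  let f2 : ContDiffBump (0 : ℝ) := ⟨ε / 2, ε, by linarith, by linarith⟩
  obtain ⟨C1, h1⟩ := exists_decay_fourierInv _ (f1.hasCompactSupport_normed (μ := volume))
    f1.contDiff_normed (d + 3)
  obtain ⟨C2, h2⟩ := exists_decay_fourierInv _ (f2.hasCompactSupport_normed (μ := volume))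
    f2.contDiff_normed (d + 3)
  refine ⟨fun z => f1.normed volume z.1 * f2.normed volume z.2, ?_, ?_, ?_, ?_, C1 * C2, ?_⟩
  · exact (f1.continuous_normed.comp continuous_fst).mul (f2.continuous_normed.comp continuous_snd)
  · exact fun z => mul_nonneg (f1.nonneg_normed _) (f2.nonneg_normed _)
  · have e1 := f1.support_normed_eq (μ := volume)
    have e2 := f2.support_normed_eq (μ := volume)
    ext z
    have e3 := Set.ext_iff.1 e1 z.1
    have e4 := Set.ext_iff.1 e2 z.2
    simp only [Function.mem_support, Metric.mem_ball, dist_zero_right, mul_ne_zero_iff] at *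
    rw [e3, e4, Prod.norm_def, max_lt_iff]
  · rw [Measure.volume_eq_prod, integral_prod_mul, f1.integral_normed, f2.integral_normed, one_mul]
  · intro l
    have key : waveCoeff (fun z : SpaceTime d => f1.normed volume z.1 * f2.normed volume z.2) l =
        (∫ v, Complex.exp ((2 * Real.pi * inner ℝ v l.1 : ℝ) * Complex.I) *
          (f1.normed volume v : ℂ)) *
        (∫ v, Complex.exp ((2 * Real.pi * inner ℝ v l.2 : ℝ) * Complex.I) *
          (f2.normed volume v : ℂ)) := by
      rw [waveCoeff, ← integral_prod_mul, ← Measure.volume_eq_prod]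
      refine integral_congr_ae (Filter.Eventually.of_forall fun z => ?_)
      have : wave l z = Complex.exp ((2 * Real.pi * inner ℝ z.1 l.1 : ℝ) * Complex.I) *
          Complex.exp ((2 * Real.pi * inner ℝ z.2 l.2 : ℝ) * Complex.I) := by
        rw [wave, ← Complex.exp_add, real_inner_comm]
        congr 1
        simp only [RCLike.inner_apply, conj_trivial]
        push_cast
        ring
      simp only [this]
      push_cast
      ring
    rw [key, norm_mul]
    have h1' := h1 l.1
    have h2' := h2 l.2
    set A := ‖∫ v, Complex.exp ((2 * Real.pi * inner ℝ v l.1 : ℝ) * Complex.I) *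
          (f1.normed volume v : ℂ)‖
    set B := ‖∫ v, Complex.exp ((2 * Real.pi * inner ℝ v l.2 : ℝ) * Complex.I) *
          (f2.normed volume v : ℂ)‖
    have h3 : (1 + ‖l‖) ^ (d + 3) ≤ (1 + ‖l.1‖) ^ (d + 3) * (1 + ‖l.2‖) ^ (d + 3) := by
      rw [← mul_pow]
      refine pow_le_pow_left₀ (by positivity) ?_ _
      have := norm_nonneg l.1
      have := norm_nonneg l.2
      rw [Prod.norm_def]
      rcases max_choice ‖l.1‖ ‖l.2‖ with h | h <;> rw [h] <;> nlinarith
    rw [← div_eq_mul_inv, le_div_iff₀ (by positivity)]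
    calc A * B * (1 + ‖l‖) ^ (d + 3)
        ≤ A * B * ((1 + ‖l.1‖) ^ (d + 3) * (1 + ‖l.2‖) ^ (d + 3)) := by gcongr
      _ = ((1 + ‖l.1‖) ^ (d + 3) * A) * ((1 + ‖l.2‖) ^ (d + 3) * B) := by ring
      _ ≤ C1 * C2 := by
        have : 0 ≤ (1 + ‖l.1‖) ^ (d + 3) * A := by positivity
        gcongr
        exact this.trans h1'

namespace IsBump
variable {ε : ℝ} {φ : SpaceTime d → ℝ}

theorem pos (h : IsBump ε φ) : 0 < ε := by
  by_contra hε
  have h1 : Function.support φ = ∅ := by rw [h.support, Metric.ball_eq_empty.2 (not_lt.1 hε)]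
  have := h.integral
  rw [Function.support_eq_empty_iff.1 h1] at this
  simp at this

theorem eq_zero (h : IsBump ε φ) {z : SpaceTime d} (hz : z ∉ Metric.ball 0 ε) : φ z = 0 := by
  rwa [← h.support, Function.notMem_support] at hz

theorem hasCompactSupport (h : IsBump ε φ) : HasCompactSupport φ :=
  HasCompactSupport.intro (isCompact_closedBall 0 ε) fun _ hz =>
    h.eq_zero fun hz' => hz (Metric.ball_subset_closedBall hz')

theorem integrable_mul {F : Type*} [NormedAddCommGroup F] [NormedSpace ℝ F] (h : IsBump ε φ)
    {f : SpaceTime d → F} (hf : Continuous f) :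
    Integrable fun z => φ z • f z :=
  (h.continuous.smul hf).integrable_of_hasCompactSupport h.hasCompactSupport.smul_right

theorem waveCoeff_zero (h : IsBump ε φ) : waveCoeff φ 0 = 1 := by
  simp only [waveCoeff, wave_zero_left, mul_one]
  rw [integral_complex_ofReal, h.integral, Complex.ofReal_one]

theorem exists_le (h : IsBump ε φ) : ∃ M, 0 < M ∧ ∀ z, φ z ≤ M := by
  obtain ⟨M, hM⟩ := h.hasCompactSupport.exists_bound_of_continuous h.continuous
  exact ⟨max M 1, by positivity, fun z => (le_abs_self _).trans ((hM z).trans (le_max_left _ _))⟩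

end IsBump

theorem norm_waveCoeff_neg (φ : SpaceTime d → ℝ) (l : SpaceTime d) :
    ‖waveCoeff φ (-l)‖ = ‖waveCoeff φ l‖ := by
  have : waveCoeff φ (-l) = starRingEnd ℂ (waveCoeff φ l) := by
    rw [waveCoeff, waveCoeff, ← integral_conj]
    simp [wave_neg_left]
  rw [this, RCLike.norm_conj]

theorem IsBump.continuous_ofReal_mul {ε : ℝ} {φ : SpaceTime d → ℝ} (h : IsBump ε φ)
    {f : SpaceTime d → ℂ} (hf : Continuous f) : Continuous fun z => (φ z : ℂ) * f z :=
  (Complex.continuous_ofReal.comp h.continuous).mul hf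

theorem IsBump.continuous_waveCoeff {ε : ℝ} {φ : SpaceTime d → ℝ} (h : IsBump ε φ) :
    Continuous (waveCoeff φ) := by
  refine continuous_of_dominated (bound := fun z => φ z) (F := fun l z => (φ z : ℂ) * wave l z)
    ?_ ?_ ?_ ?_
  · intro l
    exact (h.continuous_ofReal_mul (continuous_wave_right l)).aestronglyMeasurable
  · intro l
    filter_upwards with z
    rw [norm_mul, norm_wave, mul_one, Complex.norm_real, Real.norm_of_nonneg (h.nonneg z)]
  · simpa using h.integrable_mul (continuous_const (y := (1 : ℝ)))
  · filter_upwards with z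
    exact continuous_const.mul (continuous_wave_left z)

/-- A bump averages nontrivial waves to something other than `1`, since the phase of a wave is not
constant on the support. -/
theorem IsBump.norm_one_sub_waveCoeff_pos {ε : ℝ} {φ : SpaceTime d → ℝ} (h : IsBump ε φ)
    {l : SpaceTime d} (hl : l ≠ 0) : 0 < ‖1 - waveCoeff φ l‖ := by
  rw [norm_pos_iff]
  intro h0
  let g : SpaceTime d → ℝ := fun z => φ z * (1 - (wave l z).re)
  have hwr : Continuous fun z => (wave l z).re := Complex.continuous_re.comp
    (continuous_wave_right l)
  have hg : Continuous g := h.continuous.mul (continuous_const.sub hwr)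
  have hg0 : ∫ z, g z = 0 := by
    have e1 : ∫ z, g z = (1 : ℝ) - (waveCoeff φ l).re := by
      have : ∀ z, g z = φ z - φ z * (wave l z).re := fun z => by simp only [g]; ring
      simp_rw [this]
      rw [integral_sub, h.integral]
      · congr 1
        rw [waveCoeff, ← RCLike.re_eq_complex_re, ← integral_re]
        · refine integral_congr_ae (Filter.Eventually.of_forall fun z => ?_)
          simp
        · simpa using h.integrable_mul (continuous_wave_right l)
      · simpa using h.integrable_mul (continuous_const (y := (1 : ℝ)))
      · simpa using h.integrable_mul hwr
    rw [e1]
    have := congrArg Complex.re h0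
    simpa using this
  have hle : ∀ z, (wave l z).re ≤ 1 := fun z =>
    (Complex.re_le_norm _).trans (norm_wave l z).le
  have hg1 : 0 ≤ g := fun z => mul_nonneg (h.nonneg z) (by linarith [hle z])
  have hg2 : g = 0 := by
    by_contra hne
    obtain ⟨x, hx⟩ := Function.ne_iff.1 hne
    exact (hg.integral_pos_of_hasCompactSupport_nonneg_nonzero
      (μ := volume) h.hasCompactSupport.mul_right hg1 hx).ne' hg0
  -- on the ray through `l`, close to the origin, the phase is positive and small
  have hq : 0 < ‖l.1‖ ^ 2 + l.2 ^ 2 := by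
    by_contra hq
    have h1 : ‖l.1‖ ^ 2 = 0 := by nlinarith [sq_nonneg ‖l.1‖, sq_nonneg l.2]
    have h2 : l.2 ^ 2 = 0 := by nlinarith [sq_nonneg ‖l.1‖, sq_nonneg l.2]
    exact hl (Prod.ext (by simpa using h1) (by simpa using h2))
  set q := ‖l.1‖ ^ 2 + l.2 ^ 2
  obtain ⟨s, hs0, hs1, hs2⟩ : ∃ s : ℝ, 0 < s ∧ s * ‖l‖ < ε ∧ s * (2 * q) < 1 := by
    have he := h.pos
    have hl' : 0 < ‖l‖ := norm_pos_iff.2 hl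
    refine ⟨min (ε / (2 * ‖l‖)) (1 / (4 * q)), by positivity, ?_, ?_⟩
    · calc _ ≤ ε / (2 * ‖l‖) * ‖l‖ := by gcongr; exact min_le_left _ _
        _ = ε / 2 := by field_simp
        _ < ε := by linarith
    · calc _ ≤ 1 / (4 * q) * (2 * q) := by gcongr; exact min_le_right _ _
        _ = 1 / 2 := by field_simp; norm_num
        _ < 1 := by norm_num
  have hz : s • l ∈ Metric.ball (0 : SpaceTime d) ε := by
    rw [mem_ball_zero_iff, norm_smul, Real.norm_of_nonneg hs0.le]
    exact hs1
  rw [← h.support] at hz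
  have h3 : (wave l (s • l)).re = 1 := by
    have h3 := congrFun hg2 (s • l)
    rcases mul_eq_zero.1 h3 with h4 | h4
    · exact absurd h4 hz
    · linarith
  have h4 : (wave l (s • l)).re = Real.cos (2 * Real.pi * (s * q)) := by
    rw [wave, Complex.exp_ofReal_mul_I_re]
    simp only [Prod.smul_fst, Prod.smul_snd, inner_smul_right, smul_eq_mul,
      real_inner_self_eq_norm_sq, q]
    congr 1
    ring
  rw [h4, Real.cos_eq_one_iff_of_lt_of_lt] at h3
  · have : 0 < 2 * Real.pi * (s * q) := by positivity
    exact this.ne' h3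
  · have : 0 < 2 * Real.pi * (s * q) := by positivity
    linarith [Real.pi_pos]
  · nlinarith [Real.pi_pos]

/-- Away from the zero frequency the Fourier transform of a bump stays away from its value `1`
at zero: by compactness at bounded frequencies, by decay at large ones. -/
theorem IsBump.exists_le_norm_one_sub {ε : ℝ} {φ : SpaceTime d → ℝ} (h : IsBump ε φ) {δ : ℝ}
    (hδ : 0 < δ) : ∃ κ, 0 < κ ∧ ∀ l : SpaceTime d, δ ≤ ‖l‖ → κ ≤ ‖1 - waveCoeff φ l‖ := by
  obtain ⟨C, hC⟩ := h.decay
  have hcont := h.continuous_waveCoeff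
  have hpos : ∀ l : SpaceTime d, l ≠ 0 → 0 < ‖1 - waveCoeff φ l‖ :=
    fun l hl => h.norm_one_sub_waveCoeff_pos hl
  -- beyond the radius `2 |C|` the coefficient is at most `1 / 2`
  set K := 2 * |C|
  have hlarge : ∀ l : SpaceTime d, K ≤ ‖l‖ → 1 / 2 ≤ ‖1 - waveCoeff φ l‖ := by
    intro l hl
    have h1 : ‖waveCoeff φ l‖ ≤ 1 / 2 := by
      refine (hC l).trans ?_
      rw [← div_eq_mul_inv, div_le_iff₀ (by positivity)]
      have h2 : 1 + ‖l‖ ≤ (1 + ‖l‖) ^ (d + 3) := le_self_pow₀ (by simp) (by simp)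
      have := le_abs_self C
      simp only [K] at hl
      linarith [norm_nonneg l]
    have h2 := norm_sub_norm_le (1 : ℂ) (waveCoeff φ l)
    rw [norm_one] at h2
    linarith
  let A : Set (SpaceTime d) := Metric.closedBall 0 K ∩ {l | δ ≤ ‖l‖}
  have hA : IsCompact A := (isCompact_closedBall 0 K).inter_right
    (isClosed_le continuous_const continuous_norm)
  rcases A.eq_empty_or_nonempty with hAe | hAn
  · refine ⟨1 / 2, by norm_num, fun l hl => hlarge l ?_⟩
    by_contra hlK
    have : l ∈ A := ⟨by rw [mem_closedBall_zero_iff]; exact (not_le.1 hlK).le, hl⟩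
    rw [hAe] at this
    exact this
  · obtain ⟨m, hmA, hm⟩ := hA.exists_isMinOn hAn (continuous_const.sub hcont).norm.continuousOn
    have hm0 : m ≠ 0 := by
      rintro rfl
      have := hmA.2
      simp only [Set.mem_ofPred_eq, norm_zero] at this
      linarith
    refine ⟨min (1 / 2) ‖1 - waveCoeff φ m‖, lt_min (by norm_num) (hpos m hm0), fun l hl => ?_⟩
    rcases le_total K ‖l‖ with h1 | h1
    · exact (min_le_left _ _).trans (hlarge l h1)
    · exact (min_le_right _ _).trans (hm ⟨by rwa [mem_closedBall_zero_iff], hl⟩)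

/-! ### Sums over separated sets of frequencies -/

instance : (volume : Measure (SpaceTime d)).IsAddHaarMeasure :=
  inferInstanceAs ((volume : Measure (Space d)).prod (volume : Measure ℝ)).IsAddHaarMeasure

/-- A finite set of frequencies whose distinct elements are at distance at least `δ`. -/
def IsSep (δ : ℝ) (s : Finset (SpaceTime d)) : Prop :=
  ∀ l ∈ s, ∀ m ∈ s, l ≠ m → δ ≤ ‖l - m‖

theorem IsSep.mono {δ : ℝ} {s t : Finset (SpaceTime d)} (h : IsSep δ t) (hst : s ⊆ t) :
    IsSep δ s := fun l hl m hm => h l (hst hl) m (hst hm)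

theorem IsSep.anti {δ δ' : ℝ} {s : Finset (SpaceTime d)} (h : IsSep δ s) (hδ : δ' ≤ δ) :
    IsSep δ' s := fun l hl m hm hne => hδ.trans (h l hl m hm hne)

/-- The sums are compared with the integral over the disjoint balls around the points. -/
theorem exists_sum_decay_le {δ : ℝ} (hδ : 0 < δ) : ∃ A : ℝ, 0 < A ∧
    ∀ s : Finset (SpaceTime d), IsSep δ s → ∀ x : SpaceTime d,
      ∑ l ∈ s, ((1 + ‖l - x‖) ^ (d + 2))⁻¹ ≤ A := by
  let f : SpaceTime d → ℝ := fun z => ((1 + ‖z‖) ^ (d + 2))⁻¹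
  have hf0 : ∀ z, 0 ≤ f z := fun z => by positivity
  have hfi : Integrable f := by
    have h1 : Module.finrank ℝ (SpaceTime d) = d + 1 := by simp
    have h2 := integrable_one_add_norm (E := SpaceTime d) (μ := volume) (r := ((d + 2 : ℕ) : ℝ))
      (by rw [h1]; push_cast; linarith)
    refine h2.congr (Filter.Eventually.of_forall fun z => ?_)
    simp only [f]
    rw [Real.rpow_neg (by positivity), Real.rpow_natCast]
  set v : ℝ := volume.real (Metric.ball (0 : SpaceTime d) (δ / 2))
  have hv : 0 < v := by
    refine ENNReal.toReal_pos ?_ ?_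
    · exact (Metric.measure_ball_pos volume _ (by linarith)).ne'
    · exact measure_ball_lt_top.ne
  set K : ℝ := (1 + δ / 2) ^ (d + 2)
  have hK : 0 < K := by positivity
  have hI : 0 ≤ ∫ z, f z := integral_nonneg hf0
  refine ⟨K * (∫ z, f z) / v + 1, by positivity, fun s hs x => ?_⟩
  have hfx : Integrable fun z => f (z - x) := hfi.comp_sub_right x
  have h1 : ∀ l ∈ s, v * f (l - x) ≤ K * ∫ z in Metric.ball l (δ / 2), f (z - x) := by
    intro l _
    have h2 : v = volume.real (Metric.ball l (δ / 2)) := by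
      simp only [v, Measure.real]
      rw [Measure.addHaar_ball_center volume l]
    rw [h2, ← integral_const_mul, ← smul_eq_mul, ← setIntegral_const]
    refine setIntegral_mono_on ?_ (hfx.const_mul K).integrableOn measurableSet_ball ?_
    · exact integrableOn_const measure_ball_lt_top.ne
    · intro z hz
      rw [mem_ball_iff_norm] at hz
      have h3 : 1 + ‖z - x‖ ≤ (1 + δ / 2) * (1 + ‖l - x‖) := by
        have : ‖z - x‖ ≤ ‖z - l‖ + ‖l - x‖ := norm_sub_le_norm_sub_add_norm_sub z l x
        nlinarith [norm_nonneg (l - x)]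
      have h4 : (1 + ‖z - x‖) ^ (d + 2) ≤ K * (1 + ‖l - x‖) ^ (d + 2) := by
        rw [← mul_pow]
        exact pow_le_pow_left₀ (by positivity) h3 _
      simp only [f]
      rw [← div_eq_mul_inv, inv_eq_one_div, div_le_div_iff₀ (by positivity) (by positivity)]
      linarith
  have h2 : v * ∑ l ∈ s, f (l - x) ≤ K * ∫ z, f z := by
    calc v * ∑ l ∈ s, f (l - x) = ∑ l ∈ s, v * f (l - x) := Finset.mul_sum ..
      _ ≤ ∑ l ∈ s, K * ∫ z in Metric.ball l (δ / 2), f (z - x) := Finset.sum_le_sum h1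
      _ = K * ∫ z in ⋃ l ∈ s, Metric.ball l (δ / 2), f (z - x) := by
        rw [← Finset.mul_sum, integral_biUnion_finset]
        · exact fun l _ => measurableSet_ball
        · intro l hl m hm hne
          refine Metric.ball_disjoint_ball ?_
          rw [dist_eq_norm]
          linarith [hs l hl m hm hne]
        · exact fun l _ => hfx.integrableOn
      _ ≤ K * ∫ z, f (z - x) := by
        refine mul_le_mul_of_nonneg_left ?_ hK.le
        exact setIntegral_le_integral hfx (Filter.Eventually.of_forall fun z => hf0 _)
      _ = K * ∫ z, f z := by rw [integral_sub_right_eq_self]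
  have h3 : ∑ l ∈ s, f (l - x) ≤ K * (∫ z, f z) / v := by
    rw [le_div_iff₀ hv]
    linarith
  linarith

/-- Schur's test for a symmetric kernel. -/
theorem sum_mul_mul_le_of_sum_le {ι : Type*} (s : Finset ι) (k : ι → ι → ℝ) (a : ι → ℝ) {A : ℝ}
    (hk : ∀ i j, 0 ≤ k i j) (hsymm : ∀ i j, k i j = k j i)
    (hA : ∀ i ∈ s, ∑ j ∈ s, k i j ≤ A) :
    ∑ i ∈ s, ∑ j ∈ s, a i * a j * k i j ≤ A * ∑ i ∈ s, a i ^ 2 := by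
  have h1 : ∑ i ∈ s, ∑ j ∈ s, a i ^ 2 * k i j ≤ A * ∑ i ∈ s, a i ^ 2 := by
    rw [Finset.mul_sum]
    refine Finset.sum_le_sum fun i hi => ?_
    rw [← Finset.mul_sum, mul_comm]
    exact mul_le_mul_of_nonneg_right (hA i hi) (sq_nonneg _)
  have h2 : ∑ i ∈ s, ∑ j ∈ s, a j ^ 2 * k i j = ∑ i ∈ s, ∑ j ∈ s, a i ^ 2 * k i j := by
    rw [Finset.sum_comm]
    exact Finset.sum_congr rfl fun i _ => Finset.sum_congr rfl fun j _ => by rw [hsymm]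
  have h3 : ∑ i ∈ s, ∑ j ∈ s, a i * a j * k i j ≤
      ∑ i ∈ s, ∑ j ∈ s, (1 / 2 * (a i ^ 2 * k i j) + 1 / 2 * (a j ^ 2 * k i j)) := by
    refine Finset.sum_le_sum fun i _ => Finset.sum_le_sum fun j _ => ?_
    nlinarith [mul_nonneg (sq_nonneg (a i - a j)) (hk i j)]
  refine h3.trans ?_
  have h4 : ∑ i ∈ s, ∑ j ∈ s, (1 / 2 * (a i ^ 2 * k i j) + 1 / 2 * (a j ^ 2 * k i j)) =
      1 / 2 * ∑ i ∈ s, ∑ j ∈ s, a i ^ 2 * k i j + 1 / 2 * ∑ i ∈ s, ∑ j ∈ s, a j ^ 2 * k i j := by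
    simp only [Finset.sum_add_distrib, Finset.mul_sum]
  rw [h4, h2]
  linarith

/-- The finite sum of plane waves with frequencies in `s` and coefficients `c`. -/
def waveSum (c : SpaceTime d → ℂ) (s : Finset (SpaceTime d)) (z : SpaceTime d) : ℂ :=
  ∑ l ∈ s, c l * wave l z

theorem continuous_waveSum (c : SpaceTime d → ℂ) (s : Finset (SpaceTime d)) :
    Continuous fun z => waveSum c s z :=
  continuous_finsetSum _ fun l _ => continuous_const.mul (continuous_wave_right l)

theorem norm_sq_waveSum (c : SpaceTime d → ℂ) (s : Finset (SpaceTime d)) (z : SpaceTime d) :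
    ((‖waveSum c s z‖ ^ 2 : ℝ) : ℂ) =
      ∑ l ∈ s, ∑ m ∈ s, c l * starRingEnd ℂ (c m) * wave (l - m) z := by
  push_cast
  rw [← Complex.mul_conj', waveSum, map_sum, Finset.sum_mul_sum]
  refine Finset.sum_congr rfl fun l _ => Finset.sum_congr rfl fun m _ => ?_
  rw [wave_sub_left, map_mul]
  ring

namespace IsBump
variable {ε : ℝ} {φ : SpaceTime d → ℝ}

theorem integrable_mul_complex (h : IsBump ε φ) {f : SpaceTime d → ℂ} (hf : Continuous f) :
    Integrable fun z => (φ z : ℂ) * f z := by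
  simpa using h.integrable_mul hf

theorem integrable_mul_norm_sq (h : IsBump ε φ) {f : SpaceTime d → ℂ} (hf : Continuous f) :
    Integrable fun z => φ z * ‖f z‖ ^ 2 := by
  simpa using h.integrable_mul (hf.norm.pow 2)

theorem integral_mul_norm_sq_waveSum (h : IsBump ε φ) (c : SpaceTime d → ℂ)
    (s : Finset (SpaceTime d)) :
    ((∫ z, φ z * ‖waveSum c s z‖ ^ 2 : ℝ) : ℂ) =
      ∑ l ∈ s, ∑ m ∈ s, c l * starRingEnd ℂ (c m) * waveCoeff φ (l - m) := by
  rw [← integral_complex_ofReal]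
  simp_rw [Complex.ofReal_mul, norm_sq_waveSum, Finset.mul_sum]
  have hint : ∀ l m, Integrable fun z =>
      (φ z : ℂ) * (c l * starRingEnd ℂ (c m) * wave (l - m) z) := fun l m =>
    h.integrable_mul_complex (continuous_const.mul (continuous_wave_right _))
  rw [integral_finsetSum _ fun l _ => integrable_finsetSum _ fun m _ => hint l m]
  refine Finset.sum_congr rfl fun l _ => ?_
  rw [integral_finsetSum _ fun m _ => hint l m]
  refine Finset.sum_congr rfl fun m _ => ?_
  rw [waveCoeff, ← integral_const_mul]
  exact integral_congr_ae (Filter.Eventually.of_forall fun z => by ring)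

/-- The weighted norm of a sum of waves is close to the norm of the coefficients, if the Fourier
transform of the weight is small on differences of frequencies. -/
theorem abs_integral_sub_le (h : IsBump ε φ) (c : SpaceTime d → ℂ) (s : Finset (SpaceTime d))
    {A : ℝ} (hA : ∀ l ∈ s, ∑ m ∈ s.erase l, ‖waveCoeff φ (m - l)‖ ≤ A) :
    |(∫ z, φ z * ‖waveSum c s z‖ ^ 2) - ∑ l ∈ s, ‖c l‖ ^ 2| ≤ A * ∑ l ∈ s, ‖c l‖ ^ 2 := by
  classical
  let k : SpaceTime d → SpaceTime d → ℝ := fun l m => if m = l then 0 else ‖waveCoeff φ (m - l)‖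
  have hk : ∀ l ∈ s, ∑ m ∈ s, k l m ≤ A := by
    intro l hl
    refine le_trans (le_of_eq ?_) (hA l hl)
    rw [← Finset.add_sum_erase s _ hl]
    simp only [k, if_true, zero_add]
    exact Finset.sum_congr rfl fun m hm => if_neg (Finset.ne_of_mem_erase hm)
  refine le_trans ?_ (sum_mul_mul_le_of_sum_le s k (fun l => ‖c l‖) ?_ ?_ hk)
  · rw [← Real.norm_eq_abs, ← Complex.norm_real, Complex.ofReal_sub,
      h.integral_mul_norm_sq_waveSum, Complex.ofReal_sum, ← Finset.sum_sub_distrib]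
    refine (norm_sum_le _ _).trans (Finset.sum_le_sum fun l hl => ?_)
    rw [← Finset.add_sum_erase s _ hl, ← Finset.add_sum_erase s (fun j => _ * k l j) hl]
    have e1 : c l * starRingEnd ℂ (c l) * waveCoeff φ (l - l) = ((‖c l‖ ^ 2 : ℝ) : ℂ) := by
      rw [sub_self, h.waveCoeff_zero, mul_one, Complex.mul_conj']
      push_cast
      rfl
    rw [e1, add_sub_cancel_left]
    simp only [k, if_true, mul_zero, zero_add]
    refine (norm_sum_le _ _).trans (Finset.sum_le_sum fun m hm => ?_)
    rw [if_neg (Finset.ne_of_mem_erase hm), norm_mul, norm_mul, RCLike.norm_conj,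
      ← norm_waveCoeff_neg, neg_sub]
  · intro l m
    simp only [k]
    split_ifs <;> positivity
  · intro l m
    simp only [k, eq_comm]
    split_ifs
    · rfl
    · rw [← norm_waveCoeff_neg, neg_sub]

/-- The gain `1 / (1 + R)` for frequencies outside a ball comes from the spare power in the decay of
the Fourier transform of a bump. -/
theorem exists_sum_norm_waveCoeff_le (h : IsBump ε φ) {δ : ℝ} (hδ : 0 < δ) :
    ∃ A : ℝ, 0 < A ∧ ∀ s : Finset (SpaceTime d), IsSep δ s → ∀ R, 0 ≤ R → ∀ t ⊆ s, ∀ x,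
      (∀ l ∈ t, R ≤ ‖l - x‖) → ∑ l ∈ t, ‖waveCoeff φ (l - x)‖ ≤ A / (1 + R) := by
  obtain ⟨C, hC⟩ := h.decay
  obtain ⟨A, hA0, hA⟩ := exists_sum_decay_le (d := d) hδ
  refine ⟨(|C| + 1) * A, by positivity, fun s hs R hR t ht x hx => ?_⟩
  calc ∑ l ∈ t, ‖waveCoeff φ (l - x)‖
      ≤ ∑ l ∈ t, ((|C| + 1) / (1 + R)) * ((1 + ‖l - x‖) ^ (d + 2))⁻¹ := by
        refine Finset.sum_le_sum fun l hl => (hC _).trans ?_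
        have h1 := hx l hl
        have h2 : C ≤ |C| + 1 := by linarith [le_abs_self C]
        rw [pow_succ, mul_inv, div_eq_mul_inv]
        calc C * (((1 + ‖l - x‖) ^ (d + 2))⁻¹ * (1 + ‖l - x‖)⁻¹)
            ≤ (|C| + 1) * (((1 + ‖l - x‖) ^ (d + 2))⁻¹ * (1 + R)⁻¹) := by gcongr
          _ = _ := by ring
    _ = ((|C| + 1) / (1 + R)) * ∑ l ∈ t, ((1 + ‖l - x‖) ^ (d + 2))⁻¹ := (Finset.mul_sum ..).symm
    _ ≤ ((|C| + 1) / (1 + R)) * A := by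
        gcongr
        exact hA t (hs.mono ht) x
    _ = _ := by ring

/-- Upper bound for sums of waves with separated frequencies. -/
theorem exists_integral_le_sum (h : IsBump ε φ) {δ : ℝ} (hδ : 0 < δ) :
    ∃ A : ℝ, 0 < A ∧ ∀ s : Finset (SpaceTime d), IsSep δ s → ∀ c : SpaceTime d → ℂ,
      ∫ z, φ z * ‖waveSum c s z‖ ^ 2 ≤ A * ∑ l ∈ s, ‖c l‖ ^ 2 := by
  obtain ⟨A, hA0, hA⟩ := h.exists_sum_norm_waveCoeff_le hδ
  refine ⟨1 + A, by positivity, fun s hs c => ?_⟩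
  have := h.abs_integral_sub_le c s (A := A) fun l _ => by
    simpa using hA s hs 0 le_rfl (s.erase l) (s.erase_subset l) l fun _ _ => norm_nonneg _
  have := (abs_le.1 this).2
  linarith

/-- Bessel's inequality, dual to `IsBump.exists_integral_le_sum`. -/
theorem exists_sum_norm_integral_sq_le (h : IsBump ε φ) {δ : ℝ} (hδ : 0 < δ) :
    ∃ A : ℝ, 0 < A ∧ ∀ s : Finset (SpaceTime d), IsSep δ s → ∀ w : SpaceTime d → ℂ,
      Continuous w → ∑ l ∈ s, ‖∫ z, (φ z : ℂ) * (starRingEnd ℂ (wave l z) * w z)‖ ^ 2 ≤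
        A * ∫ z, φ z * ‖w z‖ ^ 2 := by
  obtain ⟨A, hA0, hA⟩ := h.exists_integral_le_sum hδ
  refine ⟨A, hA0, fun s hs w hw => ?_⟩
  set a : SpaceTime d → ℂ := fun l => ∫ z, (φ z : ℂ) * (starRingEnd ℂ (wave l z) * w z)
  have hconj : ∀ l : SpaceTime d, Continuous fun z => starRingEnd ℂ (wave l z) := fun l =>
    Complex.continuous_conj.comp (continuous_wave_right l)
  have hU := continuous_waveSum a s
  have h1 : ((∑ l ∈ s, ‖a l‖ ^ 2 : ℝ) : ℂ) =
      ∫ z, (φ z : ℂ) * (starRingEnd ℂ (waveSum a s z) * w z) := by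
    have e1 : ∀ z, (φ z : ℂ) * (starRingEnd ℂ (waveSum a s z) * w z) =
        ∑ l ∈ s, starRingEnd ℂ (a l) * ((φ z : ℂ) * (starRingEnd ℂ (wave l z) * w z)) := by
      intro z
      rw [waveSum, map_sum, Finset.sum_mul, Finset.mul_sum]
      refine Finset.sum_congr rfl fun l _ => ?_
      rw [map_mul]
      ring
    have hint : ∀ l ∈ s, Integrable fun z =>
        starRingEnd ℂ (a l) * ((φ z : ℂ) * (starRingEnd ℂ (wave l z) * w z)) := fun l _ =>
      (h.integrable_mul_complex ((hconj l).mul hw)).const_mul _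
    simp_rw [e1]
    rw [integral_finsetSum _ hint, Complex.ofReal_sum]
    refine Finset.sum_congr rfl fun l _ => ?_
    rw [integral_const_mul, Complex.conj_mul']
    push_cast
    rfl
  have h2 : ∑ l ∈ s, ‖a l‖ ^ 2 = ∫ z, φ z * (starRingEnd ℂ (waveSum a s z) * w z).re := by
    have h3 := congrArg Complex.re h1
    rw [Complex.ofReal_re] at h3
    rw [h3, ← RCLike.re_eq_complex_re, ← integral_re]
    · simp
    · exact h.integrable_mul_complex ((Complex.continuous_conj.comp hU).mul hw)
  have h3 : ∑ l ∈ s, ‖a l‖ ^ 2 ≤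
      ∫ z, (A / 2 * (φ z * ‖w z‖ ^ 2) + 1 / (2 * A) * (φ z * ‖waveSum a s z‖ ^ 2)) := by
    rw [h2]
    refine integral_mono ?_ ?_ fun z => ?_
    · simpa using h.integrable_mul
        (Complex.continuous_re.comp ((Complex.continuous_conj.comp hU).mul hw))
    · exact ((h.integrable_mul_norm_sq hw).const_mul _).add
        ((h.integrable_mul_norm_sq hU).const_mul _)
    · have h4 : (starRingEnd ℂ (waveSum a s z) * w z).re ≤ ‖waveSum a s z‖ * ‖w z‖ := by
        refine (Complex.re_le_norm _).trans ?_
        rw [norm_mul, RCLike.norm_conj]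
      have h5 : ‖waveSum a s z‖ * ‖w z‖ ≤
          A / 2 * ‖w z‖ ^ 2 + 1 / (2 * A) * ‖waveSum a s z‖ ^ 2 := by
        have h6 : 0 ≤ (A * ‖w z‖ - ‖waveSum a s z‖) ^ 2 / (2 * A) := by positivity
        have h7 : (A * ‖w z‖ - ‖waveSum a s z‖) ^ 2 / (2 * A) = A / 2 * ‖w z‖ ^ 2 +
            1 / (2 * A) * ‖waveSum a s z‖ ^ 2 - ‖waveSum a s z‖ * ‖w z‖ := by
          field_simp
          ring
        linarith
      calc _ ≤ φ z * (A / 2 * ‖w z‖ ^ 2 + 1 / (2 * A) * ‖waveSum a s z‖ ^ 2) :=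
            mul_le_mul_of_nonneg_left (h4.trans h5) (h.nonneg z)
        _ = _ := by ring
  rw [integral_add ((h.integrable_mul_norm_sq hw).const_mul _)
    ((h.integrable_mul_norm_sq hU).const_mul _), integral_const_mul, integral_const_mul] at h3
  have h4 := hA s hs a
  have h5 : 1 / (2 * A) * ∫ z, φ z * ‖waveSum a s z‖ ^ 2 ≤ 1 / 2 * ∑ l ∈ s, ‖a l‖ ^ 2 := by
    calc _ ≤ 1 / (2 * A) * (A * ∑ l ∈ s, ‖a l‖ ^ 2) := by gcongr
      _ = _ := by field_simp
  linarith

end IsBump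

/-! ### Local observability of sums of waves -/

/-- The Cauchy-Schwarz inequality, for integrals of products without conjugation. -/
theorem norm_integral_mul_sq_le {α : Type*} [MeasurableSpace α] {μ : Measure α} {f g : α → ℂ}
    (hf : Integrable (fun x => ‖f x‖ ^ 2) μ) (hg : Integrable (fun x => ‖g x‖ ^ 2) μ)
    (hfg : Integrable (fun x => f x * g x) μ) :
    ‖∫ x, f x * g x ∂μ‖ ^ 2 ≤ (∫ x, ‖f x‖ ^ 2 ∂μ) * ∫ x, ‖g x‖ ^ 2 ∂μ := by
  have h1 : ‖∫ x, f x * g x ∂μ‖ ≤ ∫ x, ‖f x‖ * ‖g x‖ ∂μ := by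
    refine (norm_integral_le_integral_norm _).trans (le_of_eq ?_)
    simp only [norm_mul]
  have hfg' : Integrable (fun x => ‖f x‖ * ‖g x‖) μ := by simpa only [norm_mul] using hfg.norm
  set F := ∫ x, ‖f x‖ ^ 2 ∂μ
  set G := ∫ x, ‖g x‖ ^ 2 ∂μ
  set H := ∫ x, ‖f x‖ * ‖g x‖ ∂μ
  have h2 : ∀ t : ℝ, 0 ≤ F * (t * t) + (-2 * H) * t + G := by
    intro t
    have h3 : ∫ x, (t * ‖f x‖ - ‖g x‖) ^ 2 ∂μ = F * (t * t) + (-2 * H) * t + G := by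
      have : ∀ x, (t * ‖f x‖ - ‖g x‖) ^ 2 =
          (t * t) * ‖f x‖ ^ 2 + (-2 * t) * (‖f x‖ * ‖g x‖) + ‖g x‖ ^ 2 := fun x => by ring
      simp_rw [this]
      have hi : Integrable (fun x => (t * t) * ‖f x‖ ^ 2 + (-2 * t) * (‖f x‖ * ‖g x‖)) μ :=
        (hf.const_mul _).add (hfg'.const_mul _)
      rw [integral_add hi hg, integral_add (hf.const_mul _) (hfg'.const_mul _),
        integral_const_mul, integral_const_mul]
      ring
    rw [← h3]
    exact integral_nonneg fun x => sq_nonneg _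
  have h3 := discrim_le_zero h2
  rw [discrim] at h3
  have h4 : ‖∫ x, f x * g x ∂μ‖ ^ 2 ≤ H ^ 2 := pow_le_pow_left₀ (norm_nonneg _) h1 2
  nlinarith

theorem integrableOn_ball_of_continuous {F : Type*} [NormedAddCommGroup F] {f : SpaceTime d → F}
    (hf : Continuous f) (x : SpaceTime d) (r : ℝ) : IntegrableOn f (Metric.ball x r) :=
  (hf.continuousOn.integrableOn_compact (isCompact_closedBall x r)).mono_set
    Metric.ball_subset_closedBall

theorem setIntegral_ball_comp_add (f : SpaceTime d → ℝ) (y : SpaceTime d) (r : ℝ) :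
    ∫ z in Metric.ball 0 r, f (z + y) = ∫ z in Metric.ball y r, f z := by
  rw [← integral_indicator measurableSet_ball, ← integral_indicator measurableSet_ball,
    ← integral_add_right_eq_self (Set.indicator (Metric.ball y r) f) y]
  refine integral_congr_ae (Filter.Eventually.of_forall fun z => ?_)
  simp only [Set.indicator, Metric.mem_ball, sub_zero, dist_eq_norm, add_sub_cancel_right]

theorem setIntegral_ball_comp_add_le {f : SpaceTime d → ℝ} (hf : Continuous f)
    (hf0 : ∀ z, 0 ≤ f z) {y : SpaceTime d} {r R : ℝ} (h : r + ‖y‖ ≤ R) :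
    ∫ z in Metric.ball 0 r, f (z + y) ≤ ∫ z in Metric.ball 0 R, f z := by
  rw [setIntegral_ball_comp_add]
  refine setIntegral_mono_set (integrableOn_ball_of_continuous hf _ _)
    (Filter.Eventually.of_forall hf0) (LE.le.eventuallyLE ?_)
  refine Metric.ball_subset_ball' ?_
  rwa [dist_zero_right]

/-- `Obs r C s`: sums of waves with frequencies in `s` are observable from the ball of radius `r`
with cost `C`. -/
def Obs (r C : ℝ) (s : Finset (SpaceTime d)) : Prop :=
  ∀ c : SpaceTime d → ℂ,
    ∑ l ∈ s, ‖c l‖ ^ 2 ≤ C * ∫ z in Metric.ball 0 r, ‖waveSum c s z‖ ^ 2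

/-- Observability of the single coefficient of the frequency `l`. -/
def CoeffObs (r C : ℝ) (s : Finset (SpaceTime d)) (l : SpaceTime d) : Prop :=
  ∀ c : SpaceTime d → ℂ, ‖c l‖ ^ 2 ≤ C * ∫ z in Metric.ball 0 r, ‖waveSum c s z‖ ^ 2

theorem waveSum_eq_of_subset {s t : Finset (SpaceTime d)} (hst : s ⊆ t) {c : SpaceTime d → ℂ}
    (hc : ∀ l ∈ t, l ∉ s → c l = 0) (z : SpaceTime d) : waveSum c s z = waveSum c t z :=
  Finset.sum_subset hst fun l hl hl' => by rw [hc l hl hl', zero_mul]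

theorem waveSum_congr {s : Finset (SpaceTime d)} {c c' : SpaceTime d → ℂ}
    (h : ∀ l ∈ s, c l = c' l) (z : SpaceTime d) : waveSum c s z = waveSum c' s z :=
  Finset.sum_congr rfl fun l hl => by rw [h l hl]

theorem Obs.mono {r C : ℝ} {s t : Finset (SpaceTime d)} (h : Obs r C t) (hst : s ⊆ t) :
    Obs r C s := by
  classical
  intro c
  have h1 := h (fun l => if l ∈ s then c l else 0)
  have h2 : ∀ z, waveSum (fun l => if l ∈ s then c l else 0) t z = waveSum c s z := by
    intro z
    rw [← waveSum_eq_of_subset hst fun l _ hl => if_neg hl]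
    exact waveSum_congr (fun l hl => if_pos hl) z
  simp only [h2] at h1
  refine le_trans (le_of_eq ?_) h1
  rw [← Finset.sum_subset hst]
  · exact Finset.sum_congr rfl fun l hl => by rw [if_pos hl]
  · intro l _ hl
    simp [hl]

/-- **Ingham's inequality**: sufficiently sparse frequencies are observable. -/
theorem exists_obs_of_isSep {r : ℝ} (hr : 0 < r) :
    ∃ R C : ℝ, 0 < R ∧ ∀ s : Finset (SpaceTime d), IsSep R s → Obs r C s := by
  obtain ⟨φ, h⟩ := exists_isBump (d := d) hr
  obtain ⟨A, hA0, hA⟩ := h.exists_sum_norm_waveCoeff_le one_pos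
  obtain ⟨M, hM0, hM⟩ := h.exists_le
  refine ⟨2 * A + 1, 2 * M, by positivity, fun s hs c => ?_⟩
  have h1 := h.abs_integral_sub_le c s (A := 1 / 2) fun l hl => by
    refine (hA s (hs.anti (by linarith)) (2 * A + 1) (by positivity) (s.erase l)
      (s.erase_subset l) l fun m hm => ?_).trans ?_
    · exact hs m (Finset.mem_of_mem_erase hm) l hl (Finset.ne_of_mem_erase hm)
    · rw [div_le_div_iff₀ (by positivity) (by norm_num)]
      linarith
  have h2 := (abs_le.1 h1).1
  have h3 : ∫ z, φ z * ‖waveSum c s z‖ ^ 2 ≤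
      M * ∫ z in Metric.ball 0 r, ‖waveSum c s z‖ ^ 2 := by
    rw [← setIntegral_eq_integral_of_forall_compl_eq_zero (s := Metric.ball 0 r)
      fun z hz => by rw [h.eq_zero hz, zero_mul], ← integral_const_mul]
    have hc : Continuous fun z => ‖waveSum c s z‖ ^ 2 := (continuous_waveSum c s).norm.pow 2
    refine setIntegral_mono (h.integrable_mul_norm_sq (continuous_waveSum c s)).integrableOn
      ((integrableOn_ball_of_continuous hc _ _).const_mul _) fun z => ?_
    exact mul_le_mul_of_nonneg_right (hM z) (sq_nonneg _)
  linarith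

namespace IsBump
variable {ε : ℝ} {φ : SpaceTime d → ℝ}

/-- Averaging a modulated sum of waves multiplies its coefficients. -/
theorem integral_mul_waveSum (h : IsBump ε φ) (c : SpaceTime d → ℂ) (s : Finset (SpaceTime d))
    (l z : SpaceTime d) :
    ∫ y, (φ y : ℂ) * (starRingEnd ℂ (wave l y) * waveSum c s (z + y)) =
      waveSum (fun m => c m * waveCoeff φ (m - l)) s z := by
  have e1 : ∀ y, (φ y : ℂ) * (starRingEnd ℂ (wave l y) * waveSum c s (z + y)) =
      ∑ m ∈ s, (c m * wave m z) * ((φ y : ℂ) * wave (m - l) y) := by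
    intro y
    rw [waveSum, Finset.mul_sum, Finset.mul_sum]
    refine Finset.sum_congr rfl fun m _ => ?_
    rw [wave_add_right, wave_sub_left]
    ring
  have hint : ∀ m ∈ s, Integrable fun y => (c m * wave m z) * ((φ y : ℂ) * wave (m - l) y) :=
    fun m _ => (h.integrable_mul_complex (continuous_wave_right _)).const_mul _
  simp_rw [e1]
  rw [integral_finsetSum _ hint, waveSum]
  refine Finset.sum_congr rfl fun m _ => ?_
  rw [integral_const_mul, waveCoeff]
  ring

/-- Jensen's inequality for the probability density `φ`. -/
theorem norm_integral_mul_sq_le (h : IsBump ε φ) {w : SpaceTime d → ℂ} (hw : Continuous w) :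
    ‖∫ y, (φ y : ℂ) * w y‖ ^ 2 ≤ ∫ y, φ y * ‖w y‖ ^ 2 := by
  have hs : ∀ y, (√(φ y)) ^ 2 = φ y := fun y => Real.sq_sqrt (h.nonneg y)
  have e1 : ∀ y, ‖((√(φ y) : ℝ) : ℂ)‖ ^ 2 = φ y := fun y => by
    rw [Complex.norm_real, Real.norm_of_nonneg (Real.sqrt_nonneg _), hs]
  have e2 : ∀ y, ‖((√(φ y) : ℝ) : ℂ) * w y‖ ^ 2 = φ y * ‖w y‖ ^ 2 := fun y => by
    rw [norm_mul, mul_pow, e1]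
  have e3 : ∀ y, ((√(φ y) : ℝ) : ℂ) * (((√(φ y) : ℝ) : ℂ) * w y) = (φ y : ℂ) * w y := fun y => by
    rw [← mul_assoc, ← sq, ← Complex.ofReal_pow, hs]
  have h1 := SchrodingerControl.norm_integral_mul_sq_le (μ := volume)
    (f := fun y => ((√(φ y) : ℝ) : ℂ)) (g := fun y => ((√(φ y) : ℝ) : ℂ) * w y)
  simp only [e1, e2, e3, h.integral, one_mul] at h1
  exact h1 (by simpa using h.integrable_mul (continuous_const (y := (1 : ℝ))))
    (h.integrable_mul_norm_sq hw) (h.integrable_mul_complex hw)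

theorem integrable_prod (h : IsBump ε φ) {u : SpaceTime d → ℂ} (hu : Continuous u) (r : ℝ) :
    Integrable (fun p : SpaceTime d × SpaceTime d => φ p.2 * ‖u (p.1 + p.2)‖ ^ 2)
      ((volume.restrict (Metric.ball 0 r)).prod volume) := by
  have hc : Continuous fun p : SpaceTime d × SpaceTime d => φ p.2 * ‖u (p.1 + p.2)‖ ^ 2 :=
    (h.continuous.comp continuous_snd).mul
      ((hu.comp (continuous_fst.add continuous_snd)).norm.pow 2)
  have h1 : IntegrableOn (fun p : SpaceTime d × SpaceTime d => φ p.2 * ‖u (p.1 + p.2)‖ ^ 2)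
      (Metric.ball 0 r ×ˢ Metric.ball 0 ε) (volume.prod volume) :=
    (hc.continuousOn.integrableOn_compact
      ((isCompact_closedBall 0 r).prod (isCompact_closedBall 0 ε))).mono_set
      (Set.prod_mono Metric.ball_subset_closedBall Metric.ball_subset_closedBall)
  have h2 : (volume.restrict (Metric.ball (0 : SpaceTime d) r)).prod
      (volume : Measure (SpaceTime d)) =
      (volume.prod volume).restrict (Metric.ball 0 r ×ˢ Set.univ) := by
    rw [← Measure.prod_restrict, Measure.restrict_univ]
  rw [h2]
  refine IntegrableOn.of_forall_sdiff_eq_zero h1 (measurableSet_ball.prod MeasurableSet.univ) ?_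
  rintro ⟨z, y⟩ ⟨⟨hz, _⟩, hzy⟩
  have : y ∉ Metric.ball 0 ε := fun hy => hzy ⟨hz, hy⟩
  simp only [h.eq_zero this, zero_mul]

/-- Averaging over the support of a bump enlarges the ball by its radius. -/
theorem setIntegral_integral_le (h : IsBump ε φ) {u : SpaceTime d → ℂ} (hu : Continuous u)
    (r : ℝ) : ∫ z in Metric.ball 0 r, ∫ y, φ y * ‖u (z + y)‖ ^ 2 ≤
      ∫ z in Metric.ball 0 (r + ε), ‖u z‖ ^ 2 := by
  have hint := h.integrable_prod hu r
  rw [integral_integral_swap hint]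
  have hc : Continuous fun z => ‖u z‖ ^ 2 := hu.norm.pow 2
  calc ∫ y, ∫ z in Metric.ball 0 r, φ y * ‖u (z + y)‖ ^ 2
      ≤ ∫ y, φ y * ∫ z in Metric.ball 0 (r + ε), ‖u z‖ ^ 2 := by
        refine integral_mono hint.integral_prod_right ?_ fun y => ?_
        · simpa using h.integrable_mul
            (continuous_const (y := ∫ z in Metric.ball 0 (r + ε), ‖u z‖ ^ 2))
        · simp only [integral_const_mul]
          by_cases hy : y ∈ Metric.ball 0 ε
          · refine mul_le_mul_of_nonneg_left ?_ (h.nonneg y)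
            refine setIntegral_ball_comp_add_le hc (fun z => sq_nonneg _) ?_
            rw [mem_ball_zero_iff] at hy
            linarith
          · rw [h.eq_zero hy, zero_mul, zero_mul]
    _ = _ := by rw [integral_mul_const, h.integral, one_mul]

end IsBump

/-- If each coefficient is observable then so is the sum of all of them, from a slightly larger
ball: smoothing at the scale `ε` localises the frequencies. -/
theorem exists_obs_of_coeffObs {r ε δ C : ℝ} (hε : 0 < ε) (hδ : 0 < δ) (hC : 0 ≤ C) :
    ∃ C' : ℝ, ∀ s : Finset (SpaceTime d), IsSep δ s → (∀ l ∈ s, CoeffObs r C s l) →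
      Obs (r + ε) C' s := by
  obtain ⟨φ, h⟩ := exists_isBump (d := d) hε
  obtain ⟨A, hA0, hA⟩ := h.exists_sum_norm_integral_sq_le hδ
  refine ⟨C * A, fun s hs hobs c => ?_⟩
  have hu := continuous_waveSum c s
  -- the average of the sum modulated by `l`, which has the same coefficient at `l`
  set v : SpaceTime d → SpaceTime d → ℂ := fun l => waveSum (fun m => c m * waveCoeff φ (m - l)) s
  have hv : ∀ l, Continuous (v l) := fun l => continuous_waveSum _ s
  have hv2 : ∀ l, Continuous fun z => ‖v l z‖ ^ 2 := fun l => (hv l).norm.pow 2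
  have h1 : ∀ l ∈ s, ‖c l‖ ^ 2 ≤ C * ∫ z in Metric.ball 0 r, ‖v l z‖ ^ 2 := by
    intro l hl
    have := hobs l hl (fun m => c m * waveCoeff φ (m - l))
    rwa [sub_self, h.waveCoeff_zero, mul_one] at this
  have h2 : ∀ z, ∑ l ∈ s, ‖v l z‖ ^ 2 ≤ A * ∫ y, φ y * ‖waveSum c s (z + y)‖ ^ 2 := by
    intro z
    have h3 := hA s hs (fun y => waveSum c s (z + y)) (hu.comp (continuous_const.add continuous_id))
    simpa only [h.integral_mul_waveSum] using h3
  calc ∑ l ∈ s, ‖c l‖ ^ 2 ≤ ∑ l ∈ s, C * ∫ z in Metric.ball 0 r, ‖v l z‖ ^ 2 :=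
        Finset.sum_le_sum h1
    _ = C * ∫ z in Metric.ball 0 r, ∑ l ∈ s, ‖v l z‖ ^ 2 := by
        rw [← Finset.mul_sum, integral_finsetSum _ fun l _ =>
          integrableOn_ball_of_continuous (hv2 l) _ _]
    _ ≤ C * ∫ z in Metric.ball 0 r, A * ∫ y, φ y * ‖waveSum c s (z + y)‖ ^ 2 := by
        refine mul_le_mul_of_nonneg_left ?_ hC
        refine setIntegral_mono ?_ ?_ h2
        · exact integrable_finsetSum _ fun l _ => integrableOn_ball_of_continuous (hv2 l) _ _
        · exact (h.integrable_prod hu r).integral_prod_left.const_mul A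
    _ = C * A * ∫ z in Metric.ball 0 r, ∫ y, φ y * ‖waveSum c s (z + y)‖ ^ 2 := by
        rw [integral_const_mul]
        ring
    _ ≤ C * A * ∫ z in Metric.ball 0 (r + ε), ‖waveSum c s z‖ ^ 2 := by
        refine mul_le_mul_of_nonneg_left (h.setIntegral_integral_le hu r) (by positivity)

/-! ### Gluing sets of frequencies -/

theorem Obs.mono_const {r C C' : ℝ} {s : Finset (SpaceTime d)} (h : Obs r C s) (hC : C ≤ C') :
    Obs r C' s := fun c =>
  (h c).trans (mul_le_mul_of_nonneg_right hC (integral_nonneg fun _ => sq_nonneg _))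

theorem setIntegral_ball_norm_sq_mono {u : SpaceTime d → ℂ} (hu : Continuous u) {r R : ℝ}
    (h : r ≤ R) : ∫ z in Metric.ball 0 r, ‖u z‖ ^ 2 ≤ ∫ z in Metric.ball 0 R, ‖u z‖ ^ 2 := by
  have hu2 : Continuous fun z => ‖u z‖ ^ 2 := hu.norm.pow 2
  have := setIntegral_ball_comp_add_le hu2 (fun z => sq_nonneg _) (y := 0) (r := r)
    (R := R) (by simpa using h)
  simpa only [add_zero] using this

theorem norm_add_sq_le (a b : ℂ) : ‖a + b‖ ^ 2 ≤ 2 * ‖a‖ ^ 2 + 2 * ‖b‖ ^ 2 := by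
  have h1 := pow_le_pow_left₀ (norm_nonneg _) (norm_add_le a b) 2
  nlinarith [sq_nonneg (‖a‖ - ‖b‖)]

theorem norm_sub_sq_le (a b : ℂ) : ‖a - b‖ ^ 2 ≤ 2 * ‖a‖ ^ 2 + 2 * ‖b‖ ^ 2 := by
  simpa [sub_eq_add_neg] using norm_add_sq_le a (-b)

/-- A frequency `l` added to an observable set keeps an observable coefficient. Subtracting from a
sum of waves its average modulated by `l` removes the frequency `l` and controls all the other
coefficients. -/
theorem exists_coeffObs_insert {r C ε δ : ℝ} (hr : 0 ≤ r) (hC : 0 ≤ C) (hε : 0 < ε) (hδ : 0 < δ) :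
    ∃ C' : ℝ, 0 ≤ C' ∧ ∀ (s : Finset (SpaceTime d)) (l : SpaceTime d), l ∉ s →
      IsSep δ (insert l s) → Obs r C s → CoeffObs (r + ε) C' (insert l s) l := by
  obtain ⟨φ, h⟩ := exists_isBump (d := d) hε
  obtain ⟨A, hA0, hA⟩ := h.exists_integral_le_sum hδ
  obtain ⟨M, hM0, hM⟩ := h.exists_le
  obtain ⟨κ, hκ0, hκ⟩ := h.exists_le_norm_one_sub hδ
  refine ⟨2 * M + 8 * A * C / κ ^ 2, by positivity, fun s l hl hs hobs c => ?_⟩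
  set u := waveSum c (insert l s)
  have hu : Continuous u := continuous_waveSum c _
  have hu2 : Continuous fun z => ‖u z‖ ^ 2 := hu.norm.pow 2
  set J := ∫ z in Metric.ball 0 (r + ε), ‖u z‖ ^ 2
  set c' : SpaceTime d → ℂ := fun m => c m * (1 - waveCoeff φ (m - l))
  set w := waveSum c' s
  have hw : Continuous w := continuous_waveSum c' s
  have hw1 : ∀ z, w z = u z - ∫ y, (φ y : ℂ) * (starRingEnd ℂ (wave l y) * u (z + y)) := by
    intro z
    simp only [u]
    rw [h.integral_mul_waveSum, waveSum, waveSum, ← Finset.sum_sub_distrib,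
      Finset.sum_insert hl, sub_self, h.waveCoeff_zero, mul_one, sub_self, zero_add]
    exact Finset.sum_congr rfl fun m _ => by simp only [c']; ring
  have hw2 : ∀ z, ‖w z‖ ^ 2 ≤ 2 * ‖u z‖ ^ 2 + 2 * ∫ y, φ y * ‖u (z + y)‖ ^ 2 := by
    intro z
    rw [hw1]
    refine (norm_sub_sq_le _ _).trans ?_
    have h1 : Continuous fun y => starRingEnd ℂ (wave l y) * u (z + y) :=
      (Complex.continuous_conj.comp (continuous_wave_right l)).mul
        (hu.comp (continuous_const.add continuous_id))
    have h2 := h.norm_integral_mul_sq_le h1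
    simp only [norm_mul, RCLike.norm_conj, norm_wave, one_mul] at h2
    linarith
  have hw3 : ∫ z in Metric.ball 0 r, ‖w z‖ ^ 2 ≤ 4 * J := by
    have hi := (h.integrable_prod hu r).integral_prod_left
    calc ∫ z in Metric.ball 0 r, ‖w z‖ ^ 2
        ≤ ∫ z in Metric.ball 0 r, (2 * ‖u z‖ ^ 2 + 2 * ∫ y, φ y * ‖u (z + y)‖ ^ 2) := by
          refine setIntegral_mono (integrableOn_ball_of_continuous (hw.norm.pow 2) _ _) ?_ hw2
          exact ((integrableOn_ball_of_continuous hu2 _ _).const_mul 2).add (hi.const_mul 2)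
      _ = 2 * (∫ z in Metric.ball 0 r, ‖u z‖ ^ 2) +
          2 * ∫ z in Metric.ball 0 r, ∫ y, φ y * ‖u (z + y)‖ ^ 2 := by
          rw [integral_add ((integrableOn_ball_of_continuous hu2 _ _).const_mul 2)
            (hi.const_mul 2), integral_const_mul, integral_const_mul]
      _ ≤ 4 * J := by
          have h1 := h.setIntegral_integral_le hu r
          have h2 := setIntegral_ball_norm_sq_mono hu (r := r) (R := r + ε) (by linarith)
          simp only [J]
          linarith
  have h1 : κ ^ 2 * ∑ m ∈ s, ‖c m‖ ^ 2 ≤ 4 * C * J := by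
    calc κ ^ 2 * ∑ m ∈ s, ‖c m‖ ^ 2 = ∑ m ∈ s, κ ^ 2 * ‖c m‖ ^ 2 := Finset.mul_sum ..
      _ ≤ ∑ m ∈ s, ‖c' m‖ ^ 2 := by
          refine Finset.sum_le_sum fun m hm => ?_
          have h2 : κ ≤ ‖1 - waveCoeff φ (m - l)‖ := hκ _ <|
            hs m (Finset.mem_insert_of_mem hm) l (Finset.mem_insert_self l s) fun hml =>
              hl (hml ▸ hm)
          simp only [c', norm_mul, mul_pow]
          rw [mul_comm]
          gcongr
      _ ≤ C * ∫ z in Metric.ball 0 r, ‖w z‖ ^ 2 := hobs c'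
      _ ≤ C * (4 * J) := by gcongr
      _ = _ := by ring
  have h2 : ∑ m ∈ s, ‖c m‖ ^ 2 ≤ 4 * C * J / κ ^ 2 := by
    rw [le_div_iff₀ (by positivity)]
    linarith
  have h3 : ∫ z, φ z * ‖waveSum c s z‖ ^ 2 ≤ A * (4 * C * J / κ ^ 2) :=
    (hA s (hs.mono (Finset.subset_insert l s)) c).trans (by gcongr)
  have h4 : ∫ z, φ z * ‖u z‖ ^ 2 ≤ M * J := by
    calc ∫ z, φ z * ‖u z‖ ^ 2 = ∫ z in Metric.ball 0 ε, φ z * ‖u z‖ ^ 2 :=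
          (setIntegral_eq_integral_of_forall_compl_eq_zero
            fun z hz => by rw [h.eq_zero hz, zero_mul]).symm
      _ ≤ ∫ z in Metric.ball 0 ε, M * ‖u z‖ ^ 2 := by
          refine setIntegral_mono (h.integrable_mul_norm_sq hu).integrableOn
            ((integrableOn_ball_of_continuous hu2 _ _).const_mul _) fun z => ?_
          exact mul_le_mul_of_nonneg_right (hM z) (sq_nonneg _)
      _ = M * ∫ z in Metric.ball 0 ε, ‖u z‖ ^ 2 := integral_const_mul _ _
      _ ≤ M * J := by
          refine mul_le_mul_of_nonneg_left ?_ hM0.le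
          exact setIntegral_ball_norm_sq_mono hu (by linarith)
  have h5 : ‖c l‖ ^ 2 ≤ ∫ z, (2 * (φ z * ‖u z‖ ^ 2) + 2 * (φ z * ‖waveSum c s z‖ ^ 2)) := by
    have h6 : ‖c l‖ ^ 2 = ∫ z, φ z * ‖c l‖ ^ 2 := by
      rw [integral_mul_const, h.integral, one_mul]
    rw [h6]
    refine integral_mono ?_ ?_ fun z => ?_
    · simpa using h.integrable_mul (continuous_const (y := ‖c l‖ ^ 2))
    · exact ((h.integrable_mul_norm_sq hu).const_mul 2).add
        ((h.integrable_mul_norm_sq (continuous_waveSum c s)).const_mul 2)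
    · have h7 : c l * wave l z = u z - waveSum c s z := by
        simp only [u, waveSum, Finset.sum_insert hl, add_sub_cancel_right]
      have h8 : ‖c l‖ ^ 2 ≤ 2 * ‖u z‖ ^ 2 + 2 * ‖waveSum c s z‖ ^ 2 := by
        have := norm_sub_sq_le (u z) (waveSum c s z)
        rwa [← h7, norm_mul, norm_wave, mul_one] at this
      calc φ z * ‖c l‖ ^ 2 ≤ φ z * (2 * ‖u z‖ ^ 2 + 2 * ‖waveSum c s z‖ ^ 2) :=
            mul_le_mul_of_nonneg_left h8 (h.nonneg z)
        _ = _ := by ring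
  rw [integral_add ((h.integrable_mul_norm_sq hu).const_mul 2)
    ((h.integrable_mul_norm_sq (continuous_waveSum c s)).const_mul 2), integral_const_mul,
    integral_const_mul] at h5
  calc ‖c l‖ ^ 2 ≤ 2 * (M * J) + 2 * (A * (4 * C * J / κ ^ 2)) := by linarith
    _ = _ := by ring

/-- An observable set of frequencies has biorthogonal functions on the ball: the Gram matrix of its
waves is injective, hence surjective. -/
theorem Obs.exists_dual {r C : ℝ} {s : Finset (SpaceTime d)} (h : Obs r C s) (hC : 0 ≤ C)
    {l : SpaceTime d} (hl : l ∈ s) : ∃ g : SpaceTime d → ℂ, Continuous g ∧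
      ∫ z in Metric.ball 0 r, g z * wave l z = 1 ∧
      (∀ m ∈ s, m ≠ l → ∫ z in Metric.ball 0 r, g z * wave m z = 0) ∧
      ∫ z in Metric.ball 0 r, ‖g z‖ ^ 2 ≤ C := by
  classical
  -- extension by zero, the corresponding sum of waves, and the Gram operator
  let e : (s → ℂ) → SpaceTime d → ℂ := fun a m => if hm : m ∈ s then a ⟨m, hm⟩ else 0
  have he : ∀ (a : s → ℂ) (i : s), e a i = a i := fun a i => by simp [e]
  let U : (s → ℂ) → SpaceTime d → ℂ := fun a => waveSum (e a) s
  have hU : ∀ a, Continuous (U a) := fun a => continuous_waveSum _ s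
  have hconj : ∀ m : SpaceTime d, Continuous fun z => starRingEnd ℂ (wave m z) := fun m =>
    Complex.continuous_conj.comp (continuous_wave_right m)
  have hint : ∀ (a : s → ℂ) (m : SpaceTime d),
      IntegrableOn (fun z => starRingEnd ℂ (wave m z) * U a z) (Metric.ball 0 r) := fun a m =>
    integrableOn_ball_of_continuous ((hconj m).mul (hU a)) 0 r
  let G : (s → ℂ) →ₗ[ℂ] (s → ℂ) :=
    { toFun := fun a i => ∫ z in Metric.ball 0 r, starRingEnd ℂ (wave i z) * U a z
      map_add' := by
        intro a b
        ext i
        rw [Pi.add_apply, ← integral_add (hint a i) (hint b i)]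
        refine integral_congr_ae (Filter.Eventually.of_forall fun z => ?_)
        simp only [U, waveSum]
        rw [← mul_add, ← Finset.sum_add_distrib]
        congr 1
        refine Finset.sum_congr rfl fun m hm => ?_
        simp only [e, dif_pos hm, Pi.add_apply]
        ring
      map_smul' := by
        intro t a
        ext i
        rw [Pi.smul_apply, smul_eq_mul, RingHom.id_apply, ← integral_const_mul]
        refine integral_congr_ae (Filter.Eventually.of_forall fun z => ?_)
        simp only [U, waveSum]
        rw [mul_left_comm, Finset.mul_sum s _ t]
        congr 1
        refine Finset.sum_congr rfl fun m hm => ?_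
        simp only [e, dif_pos hm, Pi.smul_apply, smul_eq_mul]
        ring }
  have hG : ∀ a : s → ℂ, ((∫ z in Metric.ball 0 r, ‖U a z‖ ^ 2 : ℝ) : ℂ) =
      ∑ i, starRingEnd ℂ (a i) * G a i := by
    intro a
    rw [← integral_complex_ofReal]
    have e1 : ∀ z, ((‖U a z‖ ^ 2 : ℝ) : ℂ) =
        ∑ i : s, starRingEnd ℂ (a i) * (starRingEnd ℂ (wave i z) * U a z) := by
      intro z
      push_cast
      rw [← Complex.conj_mul']
      conv_lhs => rw [show U a z = ∑ i : s, a i * wave i z by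
        simp only [U, waveSum]
        rw [← Finset.sum_coe_sort s]
        simp only [he]]
      rw [map_sum, Finset.sum_mul]
      refine Finset.sum_congr rfl fun i _ => ?_
      rw [map_mul, mul_assoc]
      congr 2
      simp only [U, waveSum]
      rw [← Finset.sum_coe_sort s]
      simp only [he]
    have hint' : ∀ i ∈ (Finset.univ : Finset s), IntegrableOn
        (fun z => starRingEnd ℂ (a i) * (starRingEnd ℂ (wave i z) * U a z)) (Metric.ball 0 r) :=
      fun i _ => (hint a i).const_mul _
    simp_rw [e1]
    rw [integral_finsetSum _ hint']
    exact Finset.sum_congr rfl fun i _ => integral_const_mul _ _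
  have hsum : ∀ a : s → ℂ, ∑ i, ‖a i‖ ^ 2 ≤ C * ∫ z in Metric.ball 0 r, ‖U a z‖ ^ 2 := by
    intro a
    have := h (e a)
    rw [← Finset.sum_coe_sort s] at this
    simpa only [he] using this
  have hinj : Function.Injective G := by
    rw [← LinearMap.ker_eq_bot, LinearMap.ker_eq_bot']
    intro a ha
    have h1 := hG a
    rw [ha] at h1
    simp only [Pi.zero_apply, mul_zero, Finset.sum_const_zero] at h1
    rw [Complex.ofReal_eq_zero] at h1
    have h2 := hsum a
    rw [h1, mul_zero] at h2
    ext i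
    have h3 := (Finset.single_le_sum (f := fun i => ‖a i‖ ^ 2) (fun _ _ => sq_nonneg _)
      (Finset.mem_univ i)).trans h2
    have h4 : ‖a i‖ ^ 2 = 0 := le_antisymm h3 (sq_nonneg _)
    simpa using h4
  obtain ⟨a, ha⟩ := LinearMap.injective_iff_surjective.1 hinj (Pi.single ⟨l, hl⟩ 1)
  have hval : ∀ m (hm : m ∈ s), ∫ z in Metric.ball 0 r, starRingEnd ℂ (U a z) * wave m z =
      starRingEnd ℂ ((Pi.single ⟨l, hl⟩ 1 : s → ℂ) ⟨m, hm⟩) := by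
    intro m hm
    rw [← ha]
    change _ = starRingEnd ℂ (∫ z in Metric.ball 0 r, starRingEnd ℂ (wave m z) * U a z)
    rw [← integral_conj]
    refine integral_congr_ae (Filter.Eventually.of_forall fun z => ?_)
    simp only [map_mul, Complex.conj_conj]
    ring
  refine ⟨fun z => starRingEnd ℂ (U a z), Complex.continuous_conj.comp (hU a), ?_, ?_, ?_⟩
  · rw [hval l hl, Pi.single_eq_same, map_one]
  · intro m hm hne
    rw [hval m hm, Pi.single_eq_of_ne, map_zero]
    exact fun hh => hne (congrArg Subtype.val hh)
  · simp only [RCLike.norm_conj]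
    set X := ∫ z in Metric.ball 0 r, ‖U a z‖ ^ 2
    have h1 : (X : ℂ) = starRingEnd ℂ (a ⟨l, hl⟩) := by
      rw [hG a, ha, Finset.sum_eq_single ⟨l, hl⟩]
      · rw [Pi.single_eq_same, mul_one]
      · intro i _ hi
        rw [Pi.single_eq_of_ne hi, mul_zero]
      · exact fun hh => absurd (Finset.mem_univ _) hh
    have h2 : |X| = ‖a ⟨l, hl⟩‖ := by
      rw [← RCLike.norm_conj, ← h1, Complex.norm_real, Real.norm_eq_abs]
    have h3 : X ^ 2 ≤ C * X := by
      rw [← sq_abs, h2]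
      exact (Finset.single_le_sum (f := fun i => ‖a i‖ ^ 2) (fun _ _ => sq_nonneg _)
        (Finset.mem_univ _)).trans (hsum a)
    have hX : 0 ≤ X := integral_nonneg fun z => sq_nonneg _
    nlinarith

/-- Gluing two sets of frequencies, for a single coefficient: integrating against a biorthogonal
function of the first set leaves only one of its frequencies. -/
theorem exists_coeffObs_union {r₁ r₂ C₁ C₂ ε δ : ℝ} (hr₂ : 0 ≤ r₂) (hC₁ : 0 ≤ C₁)
    (hC₂ : 0 ≤ C₂) (hε : 0 < ε) (hδ : 0 < δ) :
    ∃ C' : ℝ, 0 ≤ C' ∧ ∀ s t u : Finset (SpaceTime d), (∀ m, m ∈ u ↔ m ∈ s ∨ m ∈ t) →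
      Disjoint s t → IsSep δ u →
      Obs r₁ C₁ s → Obs r₂ C₂ t → ∀ l ∈ s, CoeffObs (r₁ + r₂ + ε) C' u l := by
  obtain ⟨C, hC0, hC⟩ := exists_coeffObs_insert (d := d) hr₂ hC₂ hε hδ
  set V := volume.real (Metric.ball (0 : SpaceTime d) (r₂ + ε))
  refine ⟨C * (V * C₁), by positivity, fun s t u hstu hst hsep hs ht l hl c => ?_⟩
  obtain ⟨g, hg, hg1, hg0, hgC⟩ := hs.exists_dual hC₁ hl
  have hsu : s ⊆ u := fun m hm => (hstu m).2 (Or.inl hm)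
  have htu : t ⊆ u := fun m hm => (hstu m).2 (Or.inr hm)
  have hlt : l ∉ t := Finset.disjoint_left.1 hst hl
  have hiu : insert l t ⊆ u := Finset.insert_subset (hsu hl) htu
  have hu := continuous_waveSum c u
  have hu2 : Continuous fun z => ‖waveSum c u z‖ ^ 2 := hu.norm.pow 2
  -- the correlation of the sum with `g`, which has frequencies in `insert l t` only
  set c' : SpaceTime d → ℂ := fun m => c m * ∫ z in Metric.ball 0 r₁, g z * wave m z
  have hw : ∀ y, waveSum c' (insert l t) y =
      ∫ z in Metric.ball 0 r₁, g z * waveSum c u (z + y) := by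
    intro y
    have e1 : ∀ z, g z * waveSum c u (z + y) =
        ∑ m ∈ u, (c m * wave m y) * (g z * wave m z) := by
      intro z
      rw [waveSum, Finset.mul_sum]
      refine Finset.sum_congr rfl fun m _ => ?_
      rw [wave_add_right]
      ring
    have hint : ∀ m ∈ u, IntegrableOn (fun z => (c m * wave m y) * (g z * wave m z))
        (Metric.ball 0 r₁) := fun m _ =>
      (integrableOn_ball_of_continuous (hg.mul (continuous_wave_right m)) _ _).const_mul _
    simp_rw [e1]
    rw [integral_finsetSum _ hint, waveSum_eq_of_subset hiu, waveSum]
    · refine Finset.sum_congr rfl fun m _ => ?_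
      rw [integral_const_mul]
      ring
    · intro m hm hm'
      rw [Finset.mem_insert, not_or] at hm'
      have hms : m ∈ s := ((hstu m).1 hm).resolve_right hm'.2
      simp only [c']
      rw [hg0 m hms hm'.1, mul_zero]
  have hcl : c' l = c l := by
    simp only [c']
    rw [hg1, mul_one]
  set J := ∫ z in Metric.ball 0 (r₁ + r₂ + ε), ‖waveSum c u z‖ ^ 2
  have hw2 : ∀ y ∈ Metric.ball (0 : SpaceTime d) (r₂ + ε),
      ‖waveSum c' (insert l t) y‖ ^ 2 ≤ C₁ * J := by
    intro y hy
    rw [mem_ball_zero_iff] at hy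
    have huy : Continuous fun z => waveSum c u (z + y) :=
      hu.comp (continuous_id.add continuous_const)
    rw [hw]
    refine (norm_integral_mul_sq_le (integrableOn_ball_of_continuous (hg.norm.pow 2) _ _)
      (integrableOn_ball_of_continuous (huy.norm.pow 2) _ _)
      (integrableOn_ball_of_continuous (hg.mul huy) _ _)).trans ?_
    refine mul_le_mul hgC ?_ (integral_nonneg fun z => sq_nonneg _) hC₁
    exact setIntegral_ball_comp_add_le hu2 (fun z => sq_nonneg _) (by linarith)
  have h1 := hC t l hlt (hsep.mono hiu) ht c'
  rw [hcl] at h1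
  refine h1.trans ?_
  rw [mul_assoc, mul_assoc]
  refine mul_le_mul_of_nonneg_left ?_ hC0
  have h2 : V * (C₁ * J) = ∫ _ in Metric.ball (0 : SpaceTime d) (r₂ + ε), C₁ * J := by
    rw [setIntegral_const, smul_eq_mul]
  rw [h2]
  refine setIntegral_mono_on ?_ (integrableOn_const measure_ball_lt_top.ne) measurableSet_ball hw2
  exact integrableOn_ball_of_continuous ((continuous_waveSum c' _).norm.pow 2) _ _

/-- Observability from the ball of radius `r`, uniformly over a family of sets of frequencies. -/
def UnifObs (r : ℝ) (P : Finset (SpaceTime d) → Prop) : Prop :=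
  ∃ C : ℝ, 0 ≤ C ∧ ∀ s, P s → Obs r C s

/-- **Kahane's gluing theorem**: a separated union of two observable sets of frequencies is
observable from any ball whose radius exceeds the sum of the radii. -/
theorem UnifObs.union {r₁ r₂ r δ : ℝ} {P Q : Finset (SpaceTime d) → Prop} (hr₁ : 0 ≤ r₁)
    (hr₂ : 0 ≤ r₂) (hr : r₁ + r₂ < r) (hδ : 0 < δ) (hP : UnifObs r₁ P) (hQ : UnifObs r₂ Q) :
    UnifObs r fun u => IsSep δ u ∧ ∃ s t, (∀ m, m ∈ u ↔ m ∈ s ∨ m ∈ t) ∧ P s ∧ Q t := by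
  classical
  obtain ⟨C₁, hC₁, h₁⟩ := hP
  obtain ⟨C₂, hC₂, h₂⟩ := hQ
  set ε := (r - r₁ - r₂) / 2
  have hε : 0 < ε := by simp only [ε]; linarith
  obtain ⟨D₁, hD₁, k₁⟩ := exists_coeffObs_union (d := d) (r₁ := r₁) hr₂ hC₁ hC₂ hε hδ
  obtain ⟨D₂, hD₂, k₂⟩ := exists_coeffObs_union (d := d) (r₁ := r₂) hr₁ hC₂ hC₁ hε hδ
  obtain ⟨D, hD⟩ := exists_obs_of_coeffObs (d := d) (r := r₁ + r₂ + ε) hε hδ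
    (le_max_of_le_left hD₁ : 0 ≤ max D₁ D₂)
  refine ⟨max D 0, le_max_right _ _, ?_⟩
  rintro u ⟨hu, s, t, hst, hs, ht⟩
  have hr' : r = r₁ + r₂ + ε + ε := by simp only [ε]; ring
  rw [hr']
  refine Obs.mono_const (hD u hu fun l hl c => ?_) (le_max_left _ _)
  have hobs1 := h₁ s hs
  have hobs2 := (h₂ t ht).mono (Finset.sdiff_subset : t \ s ⊆ t)
  have hu' : ∀ m, m ∈ u ↔ m ∈ s ∨ m ∈ t \ s := by
    intro m
    rw [hst, Finset.mem_sdiff]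
    tauto
  have hJ : 0 ≤ ∫ z in Metric.ball 0 (r₁ + r₂ + ε), ‖waveSum c u z‖ ^ 2 :=
    integral_nonneg fun z => sq_nonneg _
  rcases (hu' l).1 hl with h | h
  · refine (k₁ s (t \ s) u hu' Finset.disjoint_sdiff hu hobs1 hobs2 l h c).trans ?_
    exact mul_le_mul_of_nonneg_right (le_max_left _ _) hJ
  · have := k₂ (t \ s) s u (fun m => (hu' m).trans or_comm) Finset.sdiff_disjoint hu hobs2 hobs1
      l h c
    rw [add_comm r₂ r₁] at this
    exact this.trans (mul_le_mul_of_nonneg_right (le_max_right _ _) hJ)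

/-- Finitely many gluings cost nothing if the families are observable from arbitrarily small
balls. -/
theorem UnifObs.biUnion {ι : Type*} {δ : ℝ} (hδ : 0 < δ) (I : Finset ι)
    (P : ι → Finset (SpaceTime d) → Prop) (hP : ∀ i ∈ I, ∀ r, 0 < r → UnifObs r (P i))
    {r : ℝ} (hr : 0 < r) :
    UnifObs r fun u => IsSep δ u ∧
      ∃ f : ι → Finset (SpaceTime d), (∀ m, m ∈ u ↔ ∃ i ∈ I, m ∈ f i) ∧ ∀ i ∈ I, P i (f i) := by
  classical
  induction I using Finset.induction_on generalizing r with
  | empty =>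
    refine ⟨0, le_rfl, ?_⟩
    rintro u ⟨_, f, hf, _⟩ c
    have : u = ∅ := Finset.eq_empty_of_forall_notMem fun m hm => by simpa using (hf m).1 hm
    simp [this]
  | insert i I hi ih =>
    have h1 := ih (fun j hj => hP j (Finset.mem_insert_of_mem hj)) (r := r / 3) (by positivity)
    have h2 := hP i (Finset.mem_insert_self i I) (r / 3) (by positivity)
    obtain ⟨C, hC0, hC⟩ := UnifObs.union (by positivity) (by positivity)
      (by linarith : r / 3 + r / 3 < r) hδ h1 h2
    refine ⟨C, hC0, ?_⟩
    rintro u ⟨hu, f, hf, hfP⟩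
    refine hC u ⟨hu, I.biUnion f, f i, fun m => ?_, ⟨?_, f, fun m => ?_, ?_⟩, ?_⟩
    · rw [hf, Finset.mem_biUnion]
      simp only [Finset.exists_mem_insert]
      exact or_comm
    · refine hu.mono fun m hm => ?_
      obtain ⟨j, hj, hm⟩ := Finset.mem_biUnion.1 hm
      exact (hf m).2 ⟨j, Finset.mem_insert_of_mem hj, hm⟩
    · rw [Finset.mem_biUnion]
    · exact fun j hj => hfP j (Finset.mem_insert_of_mem hj)
    · exact hfP i (Finset.mem_insert_self i I)

/-! ### Frequencies of lattice points on the paraboloid -/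

/-- Finite sets of frequencies `(ξ, -2π|ξ|²)` of free Schrödinger waves, where `ξ` runs in a single
coset of the group `L`. -/
def IsParabolic (L : AddSubgroup (Space d)) (s : Finset (SpaceTime d)) : Prop :=
  (∀ l ∈ s, l.2 = -(2 * Real.pi * ‖l.1‖ ^ 2)) ∧ ∀ l ∈ s, ∀ m ∈ s, l.1 - m.1 ∈ L

/-- The spatial frequencies lie in a strip of width `ρ` around a translate of the orthogonal
complement of `A`. -/
def InStrip (A : Set (Space d)) (ρ : ℝ) (s : Finset (SpaceTime d)) : Prop :=
  ∀ l ∈ s, ∀ m ∈ s, ∀ a ∈ A, |inner ℝ (l.1 - m.1) a| ≤ ρ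

theorem IsParabolic.mono {L : AddSubgroup (Space d)} {s t : Finset (SpaceTime d)}
    (h : IsParabolic L t) (hst : s ⊆ t) : IsParabolic L s :=
  ⟨fun l hl => h.1 l (hst hl), fun l hl m hm => h.2 l (hst hl) m (hst hm)⟩

theorem InStrip.mono {A : Set (Space d)} {ρ : ℝ} {s t : Finset (SpaceTime d)}
    (h : InStrip A ρ t) (hst : s ⊆ t) : InStrip A ρ s :=
  fun l hl m hm => h l (hst hl) m (hst hm)

theorem IsParabolic.eq_of_fst_eq {L : AddSubgroup (Space d)} {s : Finset (SpaceTime d)}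
    (h : IsParabolic L s) {l m : SpaceTime d} (hl : l ∈ s) (hm : m ∈ s) (hlm : l.1 = m.1) :
    l = m :=
  Prod.ext hlm (by rw [h.1 l hl, h.1 m hm, hlm])

/-- Parabolic frequencies inherit a separation from the discreteness of `L`. -/
theorem exists_isSep_of_isParabolic {L : AddSubgroup (Space d)}
    (hL : ∀ R : ℝ, {m | m ∈ L ∧ ‖m‖ ≤ R}.Finite) :
    ∃ δ : ℝ, 0 < δ ∧ ∀ s, IsParabolic L s → IsSep δ s := by
  obtain ⟨δ, hδ0, hδ⟩ : ∃ δ : ℝ, 0 < δ ∧ ∀ m ∈ L, m ≠ 0 → δ ≤ ‖m‖ := by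
    have hfin : ({m | m ∈ L ∧ ‖m‖ ≤ 1} \ {0}).Finite := (hL 1).subset Set.sdiff_subset
    rcases ({m | m ∈ L ∧ ‖m‖ ≤ 1} \ {0}).eq_empty_or_nonempty with he | hne
    · refine ⟨1, one_pos, fun m hm hm0 => ?_⟩
      by_contra hlt
      have : m ∈ ({m | m ∈ L ∧ ‖m‖ ≤ 1} \ {0} : Set (Space d)) := ⟨⟨hm, (not_le.1 hlt).le⟩, hm0⟩
      rw [he] at this
      exact this
    · obtain ⟨x, hx, hmin⟩ := Set.exists_min_image _ (fun m => ‖m‖) hfin hne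
      refine ⟨‖x‖, norm_pos_iff.2 hx.2, fun m hm hm0 => ?_⟩
      rcases le_total ‖m‖ 1 with h | h
      · exact hmin m ⟨⟨hm, h⟩, hm0⟩
      · exact hx.1.2.trans h
  refine ⟨δ, hδ0, fun s hs l hl m hm hne => ?_⟩
  refine (hδ _ (hs.2 l hl m hm) fun h0 => ?_).trans (norm_fst_le (l - m))
  exact hne (hs.eq_of_fst_eq hl hm (sub_eq_zero.1 h0))

/-- A frequency set whose points are pairwise incongruent modulo the span of `A`. Two of its
frequencies are close only if the spatial frequency of the first lies in one of finitely many
strips transverse to `A`; the points outside these strips are sparse. -/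
theorem unifObs_of_transversal {L : AddSubgroup (Space d)}
    (hL : ∀ R : ℝ, {m | m ∈ L ∧ ‖m‖ ≤ R}.Finite) (A : Set (Space d))
    (ih : ∀ a ∉ Submodule.span ℝ A, ∀ ρ r : ℝ, 0 < r →
      UnifObs r fun s => IsParabolic L s ∧ InStrip (insert a A) ρ s) (ρ : ℝ) {r : ℝ} (hr : 0 < r) :
    UnifObs r fun s => IsParabolic L s ∧ InStrip A ρ s ∧
      ∀ l ∈ s, ∀ m ∈ s, l.1 - m.1 ∈ Submodule.span ℝ A → l = m := by
  classical
  obtain ⟨δ, hδ0, hδ⟩ := exists_isSep_of_isParabolic hL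
  obtain ⟨R, C, hR0, hRC⟩ := exists_obs_of_isSep (d := d) (r := r / 3) (by positivity)
  have hsparse : UnifObs (r / 3) (IsSep (d := d) R) :=
    ⟨max C 0, le_max_right _ _, fun s hs => (hRC s hs).mono_const (le_max_left _ _)⟩
  have hfin : {m | (m ∈ L ∧ ‖m‖ ≤ R) ∧ m ∉ Submodule.span ℝ A}.Finite :=
    (hL R).subset fun m hm => hm.1
  have hstrips := UnifObs.biUnion hδ0 hfin.toFinset
    (fun a s => IsParabolic L s ∧ InStrip (insert a A) (max ρ R) s)
    (fun a ha r hr => ih a ((Set.Finite.mem_toFinset hfin).1 ha).2 _ r hr)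
    (r := r / 3) (by positivity)
  obtain ⟨D, hD0, hD⟩ := UnifObs.union (by positivity) (by positivity)
    (by linarith : r / 3 + r / 3 < r) hδ0 hsparse hstrips
  refine ⟨D, hD0, ?_⟩
  rintro s ⟨hpar, hstrip, htrans⟩
  -- the points with a neighbour at spatial displacement `a`
  let f : Space d → Finset (SpaceTime d) := fun a =>
    s.filter fun l => ∃ l' ∈ s, l'.1 = l.1 + a ∧ ‖l - l'‖ < R
  have hf : ∀ a, f a ⊆ s := fun a => Finset.filter_subset _ _
  set t := hfin.toFinset.biUnion f
  have ht : t ⊆ s := Finset.biUnion_subset.2 fun a _ => hf a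
  refine hD s ⟨hδ s hpar, s \ t, t, fun m => ?_, ?_, (hδ s hpar).mono ht, f, fun m => ?_,
    fun a ha => ⟨hpar.mono (hf a), ?_⟩⟩
  · rw [Finset.mem_sdiff]
    constructor
    · intro hm
      by_cases hmt : m ∈ t
      · exact Or.inr hmt
      · exact Or.inl ⟨hm, hmt⟩
    · rintro (h | h)
      · exact h.1
      · exact ht h
  · intro l hl l' hl' hne
    by_contra hlt
    rw [Finset.mem_sdiff] at hl hl'
    refine hl.2 (Finset.mem_biUnion.2 ⟨l'.1 - l.1, (Set.Finite.mem_toFinset hfin).2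
      ⟨⟨hpar.2 l' hl'.1 l hl.1, ?_⟩, fun hspan => ?_⟩,
      Finset.mem_filter.2 ⟨hl.1, l', hl'.1, by abel, not_le.1 hlt⟩⟩)
    · have h1 := norm_fst_le (l - l')
      rw [norm_sub_rev]
      exact h1.trans (not_le.1 hlt).le
    · exact hne (htrans l' hl'.1 l hl.1 hspan).symm
  · rw [Finset.mem_biUnion]
  · -- two points of `f a` have almost the same inner product with `a`
    have key : ∀ l ∈ f a, |2 * inner ℝ l.1 a + ‖a‖ ^ 2| ≤ R := by
      intro l hl
      obtain ⟨hls, l', hl', hl1, hl2⟩ := Finset.mem_filter.1 hl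
      have h1 : |l.2 - l'.2| < R := (norm_snd_le (l - l')).trans_lt hl2
      have h2 : l.2 - l'.2 = 2 * Real.pi * (2 * inner ℝ l.1 a + ‖a‖ ^ 2) := by
        rw [hpar.1 l hls, hpar.1 l' hl', hl1, norm_add_sq_real]
        ring
      rw [h2, abs_mul, abs_of_pos Real.two_pi_pos] at h1
      nlinarith [Real.pi_gt_three, abs_nonneg (2 * inner ℝ l.1 a + ‖a‖ ^ 2)]
    intro l hl m hm b hb
    rcases Set.mem_insert_iff.1 hb with rfl | hb
    · refine le_trans ?_ (le_max_right _ _)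
      have h1 := abs_le.1 (key l hl)
      have h2 := abs_le.1 (key m hm)
      rw [inner_sub_left, abs_le]
      constructor <;> linarith [h1.1, h1.2, h2.1, h2.2]
    · exact (hstrip l (hf a hl) m (hf a hm) b hb).trans (le_max_left _ _)

/-- A point of the span of `A` is determined by its inner products with the elements of `A`, and
these depend on it in a bi-Lipschitz way. -/
theorem exists_norm_le_of_mem_span {A : Set (Space d)} (hA : A.Finite) (ρ : ℝ) :
    ∃ K : ℝ, ∀ q ∈ Submodule.span ℝ A, (∀ a ∈ A, |inner ℝ q a| ≤ ρ) → ‖q‖ ≤ K := by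
  have := hA.fintype
  let T : Submodule.span ℝ A →ₗ[ℝ] (A → ℝ) := LinearMap.pi fun a =>
    (innerₗ (Space d) (a : Space d)).comp (Submodule.span ℝ A).subtype
  have hT : ∀ q a, T q a = inner ℝ (a : Space d) (q : Space d) := fun q a => rfl
  have hker : LinearMap.ker T = ⊥ := by
    rw [LinearMap.ker_eq_bot']
    intro q hq
    have h1 : ∀ p ∈ Submodule.span ℝ A, inner ℝ p (q : Space d) = 0 := by
      intro p hp
      induction hp using Submodule.span_induction with
      | mem p hp => rw [← hT q ⟨p, hp⟩, hq, Pi.zero_apply]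
      | zero => exact inner_zero_left _
      | add x y _ _ hx hy => rw [inner_add_left, hx, hy, add_zero]
      | smul c x _ hx => rw [inner_smul_left, hx, mul_zero]
    exact Subtype.ext (inner_self_eq_zero.1 (h1 q q.2))
  obtain ⟨K, _, hK⟩ := T.exists_antilipschitzWith hker
  refine ⟨K * max ρ 0, fun q hq h => ?_⟩
  have h1 := hK.le_mul_dist ⟨q, hq⟩ 0
  rw [map_zero, dist_zero_right, dist_zero_right] at h1
  refine h1.trans ?_
  refine mul_le_mul_of_nonneg_left ?_ K.2
  refine (pi_norm_le_iff_of_nonneg (le_max_right _ _)).2 fun a => ?_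
  rw [hT, Real.norm_eq_abs, real_inner_comm]
  exact (h a a.2).trans (le_max_left _ _)

theorem finrank_span_lt_insert {A : Set (Space d)} {a : Space d}
    (ha : a ∉ Submodule.span ℝ A) :
    Module.finrank ℝ (Submodule.span ℝ A) < Module.finrank ℝ (Submodule.span ℝ (insert a A)) := by
  refine Submodule.finrank_lt_finrank_of_lt (lt_of_le_of_ne
    (Submodule.span_mono (Set.subset_insert a A)) fun h => ha ?_)
  rw [h]
  exact Submodule.subset_span (Set.mem_insert a A)

/-- Observability of parabolic frequency sets in strips, by induction on the dimension of the strip.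
The congruence classes modulo the span of `A` have boundedly many points, so that the set is a union
of boundedly many transversals. -/
theorem unifObs_of_inStrip {L : AddSubgroup (Space d)}
    (hL : ∀ R : ℝ, {m | m ∈ L ∧ ‖m‖ ≤ R}.Finite) (A : Set (Space d)) (hA : A.Finite) (ρ : ℝ)
    {r : ℝ} (hr : 0 < r) : UnifObs r fun s => IsParabolic L s ∧ InStrip A ρ s := by
  classical
  induction hn : d - Module.finrank ℝ (Submodule.span ℝ A) using Nat.strong_induction_on
    generalizing A ρ r with
  | _ n ih =>
    have ih' : ∀ a ∉ Submodule.span ℝ A, ∀ ρ r : ℝ, 0 < r →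
        UnifObs r fun s => IsParabolic L s ∧ InStrip (insert a A) ρ s := by
      intro a ha ρ r hr
      refine ih _ ?_ (insert a A) (hA.insert a) ρ hr rfl
      have h1 := finrank_span_lt_insert ha
      have h2 := Submodule.finrank_le (Submodule.span ℝ (insert a A))
      rw [finrank_euclideanSpace_fin] at h2
      omega
    obtain ⟨δ, hδ0, hδ⟩ := exists_isSep_of_isParabolic hL
    obtain ⟨K, hK⟩ := exists_norm_le_of_mem_span hA ρ
    have hfin : {q | q ∈ L ∧ q ∈ Submodule.span ℝ A ∧ ∀ a ∈ A, |inner ℝ q a| ≤ ρ}.Finite :=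
      (hL K).subset fun q hq => ⟨hq.1, hK q hq.2.1 hq.2.2⟩
    obtain ⟨D, hD0, hD⟩ := UnifObs.biUnion hδ0 hfin.toFinset
      (fun _ s => IsParabolic L s ∧ InStrip A ρ s ∧
        ∀ l ∈ s, ∀ m ∈ s, l.1 - m.1 ∈ Submodule.span ℝ A → l = m)
      (fun _ _ r hr => unifObs_of_transversal hL A ih' ρ hr) hr
    refine ⟨D, hD0, ?_⟩
    rintro s ⟨hpar, hstrip⟩
    -- choose a representative of each class, and sort the points by their displacement from it
    let F : SpaceTime d → Space d ⧸ Submodule.span ℝ A := fun l => Submodule.Quotient.mk l.1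
    let rep : SpaceTime d → SpaceTime d := fun l => Function.invFunOn F s (F l)
    have hrep : ∀ l ∈ s, rep l ∈ s ∧ F (rep l) = F l := fun l hl =>
      ⟨Function.invFunOn_mem ⟨l, hl, rfl⟩, Function.invFunOn_eq ⟨l, hl, rfl⟩⟩
    let f : Space d → Finset (SpaceTime d) := fun q => s.filter fun l => l.1 - (rep l).1 = q
    have hf : ∀ q, f q ⊆ s := fun q => Finset.filter_subset _ _
    refine hD s ⟨hδ s hpar, f, fun l => ⟨fun hl => ?_, ?_⟩, fun q _ =>
      ⟨hpar.mono (hf q), hstrip.mono (hf q), fun l hl m hm hlm => ?_⟩⟩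
    · have h1 := hrep l hl
      refine ⟨l.1 - (rep l).1, (Set.Finite.mem_toFinset hfin).2 ⟨hpar.2 l hl _ h1.1, ?_,
        hstrip l hl _ h1.1⟩, Finset.mem_filter.2 ⟨hl, rfl⟩⟩
      exact (Submodule.Quotient.eq _).1 h1.2.symm
    · rintro ⟨q, _, hl⟩
      exact hf q hl
    · have h1 := Finset.mem_filter.1 hl
      have h2 := Finset.mem_filter.1 hm
      have h3 : rep l = rep m := by
        have h4 : F l = F m := (Submodule.Quotient.eq _).2 hlm
        simp only [rep, h4]
      refine hpar.eq_of_fst_eq h1.1 h2.1 ?_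
      have h4 := h1.2.trans h2.2.symm
      rw [h3] at h4
      exact sub_left_injective h4

/-- **Observability of lattice Schrödinger waves**, uniformly over the cosets of the lattice and the
centres of the balls. -/
theorem exists_sum_le_integral_waveSum {L : AddSubgroup (Space d)}
    (hL : ∀ R : ℝ, {m | m ∈ L ∧ ‖m‖ ≤ R}.Finite) {r : ℝ} (hr : 0 < r) (z₀ : SpaceTime d) :
    ∃ C : ℝ, 0 ≤ C ∧ ∀ s, IsParabolic L s → ∀ c : SpaceTime d → ℂ,
      ∑ l ∈ s, ‖c l‖ ^ 2 ≤ C * ∫ z in Metric.ball z₀ r, ‖waveSum c s z‖ ^ 2 := by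
  obtain ⟨C, hC0, hC⟩ := unifObs_of_inStrip hL ∅ Set.finite_empty 0 hr
  refine ⟨C, hC0, fun s hs c => ?_⟩
  -- moving the centre of the ball to the origin multiplies the coefficients by phases
  have h1 := hC s ⟨hs, fun l _ m _ a ha => absurd ha (Set.notMem_empty a)⟩
    (fun l => c l * wave l z₀)
  simp only [norm_mul, norm_wave, mul_one] at h1
  refine h1.trans (le_of_eq ?_)
  rw [← setIntegral_ball_comp_add (fun z => ‖waveSum c s z‖ ^ 2) z₀ r]
  refine congrArg (C * ·) (integral_congr_ae (Filter.Eventually.of_forall fun z => ?_))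
  simp only [waveSum]
  congr 2
  refine Finset.sum_congr rfl fun l _ => ?_
  rw [wave_add_right]
  ring

/-! ### Fourier series on the unit cube -/

/-- The half-open unit cube. -/
def unitCube (d : ℕ) : Set (Fin d → ℝ) := {s | ∀ i, s i ∈ Set.Ioc (0 : ℝ) (0 + 1)}

theorem measurableSet_unitCube : MeasurableSet (unitCube d) :=
  MeasurableSet.univ_pi' fun _ => measurableSet_Ioc

theorem unitCube_subset : unitCube d ⊆ Set.Icc 0 1 := fun s hs =>
  ⟨fun i => (hs i).1.le, fun i => by simpa using (hs i).2⟩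

theorem integrableOn_unitCube {F : Type*} [NormedAddCommGroup F] {f : (Fin d → ℝ) → F}
    (hf : Continuous f) : IntegrableOn f (unitCube d) :=
  (hf.continuousOn.integrableOn_compact isCompact_Icc).mono_set unitCube_subset

/-- The vector of `ℝ^d` with the given integer coordinates. -/
def intVec (n : Fin d → ℤ) : Fin d → ℝ := fun i => n i

/-- The translates of the unit cube by integer vectors. -/
def cubeAt (n : Fin d → ℤ) : Set (Fin d → ℝ) := {s | s - intVec n ∈ unitCube d}

theorem measurableSet_cubeAt (n : Fin d → ℤ) : MeasurableSet (cubeAt n) :=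
  measurableSet_unitCube.preimage (measurable_id.sub_const _)

theorem add_intVec_mem_cubeAt_iff (s : Fin d → ℝ) (n : Fin d → ℤ) :
    s + intVec n ∈ cubeAt n ↔ s ∈ unitCube d := by
  rw [cubeAt, Set.mem_ofPred_eq, add_sub_cancel_right]

theorem iUnion_cubeAt : ⋃ n : Fin d → ℤ, cubeAt n = Set.univ := by
  refine Set.eq_univ_of_forall fun s => Set.mem_iUnion.2 ⟨fun i => ⌈s i⌉ - 1, fun i => ?_⟩
  simp only [intVec, Pi.sub_apply, Int.cast_sub, Int.cast_one, Set.mem_Ioc]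
  constructor <;> linarith [Int.le_ceil (s i), Int.ceil_lt_add_one (s i)]

theorem pairwise_disjoint_cubeAt : Pairwise (Function.onFun Disjoint (cubeAt (d := d))) := by
  intro m n hmn
  refine Set.disjoint_left.2 fun s hm hn => hmn (funext fun i => ?_)
  have h1 := hm i
  have h2 := hn i
  simp only [intVec, Pi.sub_apply, Set.mem_Ioc] at h1 h2
  have h3 : ((m i : ℤ) : ℝ) < n i + 1 := by linarith [h1.1, h2.2]
  have h4 : ((n i : ℤ) : ℝ) < m i + 1 := by linarith [h2.1, h1.2]
  have h5 : m i < n i + 1 := by exact_mod_cast h3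
  have h6 : n i < m i + 1 := by exact_mod_cast h4
  omega

theorem lintegral_cubeAt (F : (Fin d → ℝ) → ENNReal) (n : Fin d → ℤ) :
    ∫⁻ s in cubeAt n, F s = ∫⁻ s in unitCube d, F (s + intVec n) := by
  rw [← lintegral_indicator (measurableSet_cubeAt n), ← lintegral_indicator measurableSet_unitCube,
    ← lintegral_add_right_eq_self _ (intVec n)]
  refine lintegral_congr fun s => ?_
  by_cases hs : s ∈ unitCube d
  · rw [Set.indicator_of_mem ((add_intVec_mem_cubeAt_iff s n).2 hs), Set.indicator_of_mem hs]
  · rw [Set.indicator_of_notMem (mt (add_intVec_mem_cubeAt_iff s n).1 hs),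
      Set.indicator_of_notMem hs]

theorem integral_cubeAt (F : (Fin d → ℝ) → ℂ) (n : Fin d → ℤ) :
    ∫ s in cubeAt n, F s = ∫ s in unitCube d, F (s + intVec n) := by
  rw [← integral_indicator (measurableSet_cubeAt n), ← integral_indicator measurableSet_unitCube,
    ← integral_add_right_eq_self _ (intVec n)]
  refine integral_congr_ae (Filter.Eventually.of_forall fun s => ?_)
  beta_reduce
  by_cases hs : s ∈ unitCube d
  · rw [Set.indicator_of_mem ((add_intVec_mem_cubeAt_iff s n).2 hs), Set.indicator_of_mem hs]
  · rw [Set.indicator_of_notMem (mt (add_intVec_mem_cubeAt_iff s n).1 hs),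
      Set.indicator_of_notMem hs]

theorem lintegral_eq_sum_unitCube (F : (Fin d → ℝ) → ENNReal) (K : Finset (Fin d → ℤ))
    (hK : ∀ n ∉ K, ∀ s ∈ unitCube d, F (s + intVec n) = 0) :
    ∫⁻ s, F s = ∑ n ∈ K, ∫⁻ s in unitCube d, F (s + intVec n) := by
  rw [← setLIntegral_univ, ← iUnion_cubeAt,
    lintegral_iUnion measurableSet_cubeAt pairwise_disjoint_cubeAt]
  simp_rw [lintegral_cubeAt]
  refine tsum_eq_sum fun n hn => ?_
  rw [setLIntegral_congr_fun measurableSet_unitCube (hK n hn), lintegral_zero]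

theorem integral_eq_sum_unitCube {F : (Fin d → ℝ) → ℂ} (hF : Integrable F)
    (K : Finset (Fin d → ℤ)) (hK : ∀ n ∉ K, ∀ s ∈ unitCube d, F (s + intVec n) = 0) :
    ∫ s, F s = ∑ n ∈ K, ∫ s in unitCube d, F (s + intVec n) := by
  rw [← setIntegral_univ, ← iUnion_cubeAt,
    integral_iUnion measurableSet_cubeAt pairwise_disjoint_cubeAt hF.integrableOn]
  simp_rw [integral_cubeAt]
  refine tsum_eq_sum fun n hn => ?_
  rw [setIntegral_congr_fun measurableSet_unitCube (hK n hn), integral_zero]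

/-- The measure on `ℝ / ℤ` for which Mathlib develops Fourier series in several variables. -/
local instance : MeasureSpace UnitAddCircle := ⟨AddCircle.haarAddCircle⟩

/-- The measure of this instance is a probability measure. -/
local instance : IsProbabilityMeasure (volume : Measure UnitAddCircle) :=
  inferInstanceAs (IsProbabilityMeasure AddCircle.haarAddCircle)

theorem mFourier_intCast (n : Fin d → ℤ) (s : Fin d → ℝ) :
    UnitAddTorus.mFourier n (fun i => (s i : UnitAddCircle)) =
      Complex.exp (((2 * Real.pi * ∑ i, n i * s i : ℝ) : ℂ) * Complex.I) := by
  simp only [UnitAddTorus.mFourier, ContinuousMap.coe_mk, fourier_coe_apply, ← Complex.exp_sum]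
  congr 1
  push_cast
  rw [Finset.mul_sum, Finset.sum_mul]
  refine Finset.sum_congr rfl fun i _ => ?_
  ring

theorem enorm_sq_eq (z : ℂ) : ‖z‖ₑ ^ 2 = ENNReal.ofReal (‖z‖ ^ 2) := by
  rw [ENNReal.ofReal_pow (norm_nonneg _), ofReal_norm]

/-- **Parseval's identity** on the unit cube. -/
theorem tsum_enorm_integral_unitCube_sq {F : (Fin d → ℝ) → ℂ} (hF : Continuous F) :
    ∑' n : Fin d → ℤ, ‖∫ s in unitCube d,
      Complex.exp (((2 * Real.pi * ∑ i, n i * s i : ℝ) : ℂ) * Complex.I) * F s‖ₑ ^ 2 =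
      ∫⁻ s in unitCube d, ‖F s‖ₑ ^ 2 := by
  obtain ⟨M, hM⟩ := (isCompact_Icc (a := (0 : Fin d → ℝ)) (b := 1)).exists_bound_of_continuousOn
    hF.continuousOn
  let f : UnitAddTorus (Fin d) → ℂ := fun x => F (UnitAddTorus.measurableEquivPiIoc 0 x)
  have hfm : Measurable f := hF.measurable.comp
    (measurable_subtype_coe.comp (UnitAddTorus.measurableEquivPiIoc 0).measurable)
  have hfs : ∀ s ∈ unitCube d, f (fun i => (s i : UnitAddCircle)) = F s := by
    intro s hs
    have h1 := (UnitAddTorus.measurableEquivPiIoc (ι := Fin d) 0).apply_symm_apply ⟨s, hs⟩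
    rw [UnitAddTorus.coe_symm_measurableEquivPiIoc_apply] at h1
    simp only [f]
    rw [h1]
  have hfb : ∀ x, ‖f x‖ ≤ M := fun x =>
    hM _ (unitCube_subset (UnitAddTorus.measurableEquivPiIoc 0 x).2)
  have hf2 : MemLp f 2 (volume : Measure (UnitAddTorus (Fin d))) :=
    MemLp.of_bound hfm.aestronglyMeasurable M (Filter.Eventually.of_forall hfb)
  have h1 := UnitAddTorus.hasSum_sq_mFourierCoeff (hf2.toLp f)
  have h2 : ∀ n, UnitAddTorus.mFourierCoeff (hf2.toLp f) (-n) = ∫ s in unitCube d,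
      Complex.exp (((2 * Real.pi * ∑ i, n i * s i : ℝ) : ℂ) * Complex.I) * F s := by
    intro n
    have h3 : UnitAddTorus.mFourierCoeff (hf2.toLp f) (-n) = UnitAddTorus.mFourierCoeff f (-n) := by
      refine integral_congr_ae ?_
      filter_upwards [hf2.coeFn_toLp] with x hx
      rw [hx]
    rw [h3, UnitAddTorus.mFourierCoeff_eq_integral f (-n) 0, neg_neg]
    refine setIntegral_congr_fun measurableSet_unitCube fun s hs => ?_
    simp only [hfs s hs, mFourier_intCast, smul_eq_mul]
  have h3 : ∫ x, ‖hf2.toLp f x‖ ^ 2 = ∫ s in unitCube d, ‖F s‖ ^ 2 := by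
    have h4 : ∫ x, ‖hf2.toLp f x‖ ^ 2 = ∫ x, ‖f x‖ ^ 2 := by
      refine integral_congr_ae ?_
      filter_upwards [hf2.coeFn_toLp] with x hx
      rw [hx]
    rw [h4, UnitAddTorus.integral_preimage _ 0]
    exact setIntegral_congr_fun measurableSet_unitCube fun s hs => by simp only [hfs s hs]
  rw [h3] at h1
  have h5 := (Equiv.neg (Fin d → ℤ)).tsum_eq
    fun n => ENNReal.ofReal (‖UnitAddTorus.mFourierCoeff (hf2.toLp f) n‖ ^ 2)
  simp only [Equiv.neg_apply] at h5
  simp_rw [← h2, enorm_sq_eq]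
  rw [h5, ← ENNReal.ofReal_tsum_of_nonneg (fun n => sq_nonneg _) h1.summable, h1.tsum_eq,
    ofReal_integral_eq_lintegral_ofReal]
  · exact integrableOn_unitCube (hF.norm.pow 2)
  · exact Filter.Eventually.of_forall fun s => sq_nonneg _

/-! ### Observability of free waves from a periodic set -/

/-- The frequency on the paraboloid above `ξ`. -/
def parabFreq (ξ : Space d) : SpaceTime d := (ξ, -(2 * Real.pi * ‖ξ‖ ^ 2))

theorem continuous_parabFreq : Continuous (parabFreq (d := d)) := by
  unfold parabFreq
  fun_prop

/-- The solution of the free Schrödinger equation whose initial datum has Fourier transform `g`. -/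
def freeWave (g : Space d → ℂ) (z : SpaceTime d) : ℂ := ∫ ξ, g ξ * wave (parabFreq ξ) z

/-- The coordinates of `ξ` in the basis dual to `b`, that is, the inner products with `b`. -/
def dualCoord (b : Module.Basis (Fin d) ℝ (Space d)) : Space d ≃L[ℝ] (Fin d → ℝ) :=
  (LinearMap.linearEquivOfInjective (LinearMap.pi fun i => innerₗ (Space d) (b i))
    (by
      rw [← LinearMap.ker_eq_bot, LinearMap.ker_eq_bot']
      intro ξ hξ
      have h1 : ∀ i, inner ℝ (b i) ξ = 0 := fun i => congrFun hξ i
      rw [← inner_self_eq_zero (𝕜 := ℝ)]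
      nth_rewrite 1 [← b.sum_repr ξ]
      rw [sum_inner]
      exact Finset.sum_eq_zero fun i _ => by rw [inner_smul_left, h1, mul_zero])
    (by simp)).toContinuousLinearEquiv

theorem dualCoord_apply (b : Module.Basis (Fin d) ℝ (Space d)) (ξ : Space d) (i : Fin d) :
    dualCoord b ξ i = inner ℝ (b i) ξ := rfl

/-- The lattice dual to the one spanned by `b`. -/
def dualLattice (b : Module.Basis (Fin d) ℝ (Space d)) : AddSubgroup (Space d) where
  carrier := {ξ | ∃ n : Fin d → ℤ, dualCoord b ξ = intVec n}
  zero_mem' := ⟨0, by rw [map_zero]; ext i; simp [intVec]⟩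
  add_mem' := by
    rintro ξ η ⟨m, hm⟩ ⟨n, hn⟩
    exact ⟨m + n, by rw [map_add, hm, hn]; ext i; simp [intVec]⟩
  neg_mem' := by
    rintro ξ ⟨m, hm⟩
    exact ⟨-m, by rw [map_neg, hm]; ext i; simp [intVec]⟩

theorem finite_norm_intVec_le (R : ℝ) : {n : Fin d → ℤ | ‖intVec n‖ ≤ R}.Finite := by
  refine (Set.finite_Icc (fun _ : Fin d => -⌈R⌉) (fun _ => ⌈R⌉)).subset fun n hn => ?_
  have h1 : ∀ i, |(n i : ℝ)| ≤ ⌈R⌉ := fun i =>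
    ((norm_le_pi_norm (intVec n) i).trans hn).trans (Int.le_ceil R)
  refine ⟨fun i => ?_, fun i => ?_⟩
  · have h2 := (abs_le.1 (h1 i)).1
    exact_mod_cast h2
  · have h2 := (abs_le.1 (h1 i)).2
    exact_mod_cast h2

theorem finite_dualLattice_norm_le (b : Module.Basis (Fin d) ℝ (Space d)) (R : ℝ) :
    {ξ | ξ ∈ dualLattice b ∧ ‖ξ‖ ≤ R}.Finite := by
  refine ((finite_norm_intVec_le (‖(dualCoord b : Space d →L[ℝ] (Fin d → ℝ))‖ * R)).image
    fun n => (dualCoord b).symm (intVec n)).subset ?_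
  rintro ξ ⟨⟨n, hn⟩, hR⟩
  refine ⟨n, ?_, by beta_reduce; rw [← hn, ContinuousLinearEquiv.symm_apply_apply]⟩
  rw [Set.mem_ofPred_eq, ← hn]
  exact ((dualCoord b : Space d →L[ℝ] (Fin d → ℝ)).le_opNorm ξ).trans
    (mul_le_mul_of_nonneg_left hR (norm_nonneg _))

/-- Lebesgue measure in the coordinates `dualCoord b`, up to a constant. -/
theorem exists_volume_eq_smul_map (b : Module.Basis (Fin d) ℝ (Space d)) :
    ∃ c : NNReal, c ≠ 0 ∧ (volume : Measure (Space d)) =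
      c • Measure.map (dualCoord b).symm volume := by
  have := (dualCoord b).symm.isAddHaarMeasure_map volume
  exact ⟨_, (Measure.addHaarScalarFactor_pos_of_isAddHaarMeasure _ _).ne',
    Measure.isAddLeftInvariant_eq_smul _ _⟩

/-- The period with integer coordinates `n` in the basis `b`. -/
def period (b : Module.Basis (Fin d) ℝ (Space d)) (n : Fin d → ℤ) : Space d := ∑ i, n i • b i

theorem add_period_mem_iff {S : Set (Space d)} {b : Module.Basis (Fin d) ℝ (Space d)}
    (hb : ∀ (i : Fin d) (x : Space d), x + b i ∈ S ↔ x ∈ S) (n : Fin d → ℤ) (x : Space d) :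
    x + period b n ∈ S ↔ x ∈ S := by
  let H : AddSubgroup (Space d) :=
    { carrier := {v | ∀ x, x + v ∈ S ↔ x ∈ S}
      zero_mem' := fun x => by rw [add_zero]
      add_mem' := fun {v w} hv hw x => by rw [← add_assoc, hw, hv]
      neg_mem' := fun {v} hv x => by rw [← hv (x + -v), neg_add_cancel_right] }
  have h1 : period b n ∈ H := H.sum_mem fun i _ => H.zsmul_mem (hb i) _
  exact h1 x

theorem inner_period (b : Module.Basis (Fin d) ℝ (Space d)) (n : Fin d → ℤ) (ξ : Space d) :
    inner ℝ ξ (period b n) = ∑ i, n i * dualCoord b ξ i := by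
  rw [period, inner_sum]
  refine Finset.sum_congr rfl fun i _ => ?_
  rw [← Int.cast_smul_eq_zsmul ℝ, inner_smul_right, dualCoord_apply, real_inner_comm]

theorem wave_add_period (b : Module.Basis (Fin d) ℝ (Space d)) (n : Fin d → ℤ) (l z : SpaceTime d) :
    wave l (z + (period b n, 0)) = wave l z *
      Complex.exp (((2 * Real.pi * ∑ i, n i * dualCoord b l.1 i : ℝ) : ℂ) * Complex.I) := by
  rw [wave_add_right]
  congr 1
  rw [wave, inner_period, mul_zero, add_zero]

theorem exists_le_norm_period (b : Module.Basis (Fin d) ℝ (Space d)) :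
    ∃ δ : ℝ, 0 < δ ∧ ∀ n : Fin d → ℤ, n ≠ 0 → δ ≤ ‖period b n‖ := by
  set E := (b.equivFunL : Space d →L[ℝ] (Fin d → ℝ))
  refine ⟨(‖E‖ + 1)⁻¹, by positivity, fun n hn => ?_⟩
  obtain ⟨i, hi⟩ := Function.ne_iff.1 hn
  have h1 : E (period b n) = intVec n := by
    have : b.equivFun (period b n) = intVec n := by
      rw [← b.equivFun.apply_symm_apply (intVec n), b.equivFun_symm_apply]
      simp only [period, intVec, Int.cast_smul_eq_zsmul]
    exact this
  have h2 : 1 ≤ ‖intVec n‖ := by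
    refine le_trans ?_ (norm_le_pi_norm (intVec n) i)
    rw [intVec, Real.norm_eq_abs]
    exact_mod_cast Int.one_le_abs hi
  rw [← h1] at h2
  have h3 := E.le_opNorm (period b n)
  rw [inv_le_iff_one_le_mul₀ (by positivity)]
  nlinarith [norm_nonneg (period b n)]

section Floquet

variable (b : Module.Basis (Fin d) ℝ (Space d)) (g : Space d → ℂ) (K : Finset (Fin d → ℤ))

/-- The fibre at `s` of the Floquet decomposition of the free wave `freeWave g`. The sum is
restricted to a finite set `K`, which contains all integer vectors that contribute when `g` has
compact support. -/
def fibreWave (s : Fin d → ℝ) (z : SpaceTime d) : ℂ :=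
  ∑ n ∈ K, g ((dualCoord b).symm (s + intVec n)) *
    wave (parabFreq ((dualCoord b).symm (s + intVec n))) z

variable {g}

theorem continuous_fibreWave (hg : Continuous g) :
    Continuous fun p : (Fin d → ℝ) × SpaceTime d => fibreWave b g K p.1 p.2 := by
  refine continuous_finsetSum _ fun n _ => ?_
  have h1 : Continuous fun p : (Fin d → ℝ) × SpaceTime d =>
      (dualCoord b).symm (p.1 + intVec n) :=
    (dualCoord b).symm.continuous.comp (continuous_fst.add continuous_const)
  refine (hg.comp h1).mul ?_
  unfold wave parabFreq
  fun_prop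

/-- The Floquet fibres are sums of waves over a coset of the dual lattice. -/
theorem exists_sum_le_integral_fibreWave {r : ℝ} (hr : 0 < r) (z₀ : SpaceTime d) :
    ∃ C : ℝ, 0 ≤ C ∧ ∀ (g : Space d → ℂ) (K : Finset (Fin d → ℤ)) (s : Fin d → ℝ),
      ∑ n ∈ K, ‖g ((dualCoord b).symm (s + intVec n))‖ ^ 2 ≤
        C * ∫ z in Metric.ball z₀ r, ‖fibreWave b g K s z‖ ^ 2 := by
  classical
  obtain ⟨C, hC0, hC⟩ := exists_sum_le_integral_waveSum (finite_dualLattice_norm_le b) hr z₀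
  refine ⟨C, hC0, fun g K s => ?_⟩
  let p : (Fin d → ℤ) → SpaceTime d := fun n => parabFreq ((dualCoord b).symm (s + intVec n))
  have hp : Function.Injective p := by
    intro m n hmn
    have h1 := (dualCoord b).symm.injective (congrArg Prod.fst hmn)
    have h2 := add_left_cancel h1
    refine funext fun i => ?_
    have h3 := congrFun h2 i
    simp only [intVec] at h3
    exact_mod_cast h3
  have h1 := hC (K.image p) ⟨?_, ?_⟩ fun l => g l.1
  · rw [Finset.sum_image hp.injOn] at h1
    refine h1.trans (le_of_eq ?_)
    refine congrArg (C * ·) (integral_congr_ae (Filter.Eventually.of_forall fun z => ?_))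
    beta_reduce
    rw [waveSum, Finset.sum_image hp.injOn]
    rfl
  · intro l hl
    obtain ⟨n, _, rfl⟩ := Finset.mem_image.1 hl
    rfl
  · intro l hl m hm
    obtain ⟨n, _, rfl⟩ := Finset.mem_image.1 hl
    obtain ⟨k, _, rfl⟩ := Finset.mem_image.1 hm
    refine ⟨n - k, ?_⟩
    simp only [p, parabFreq]
    rw [map_sub, ContinuousLinearEquiv.apply_symm_apply, ContinuousLinearEquiv.apply_symm_apply]
    ext i
    simp [intVec]

variable {b K}

/-- Along the periods the free wave takes the Fourier coefficients of its Floquet fibres. -/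
theorem freeWave_add_period (hg : Continuous g) (hgc : HasCompactSupport g)
    (hK : ∀ n ∉ K, ∀ s ∈ unitCube d, g ((dualCoord b).symm (s + intVec n)) = 0) {c : NNReal}
    (hc : (volume : Measure (Space d)) = c • Measure.map (dualCoord b).symm volume)
    (n : Fin d → ℤ) (z : SpaceTime d) :
    freeWave g (z + (period b n, 0)) = (c : ℂ) * ∫ s in unitCube d,
      Complex.exp (((2 * Real.pi * ∑ i, n i * s i : ℝ) : ℂ) * Complex.I) * fibreWave b g K s z := by
  set κ := (dualCoord b).symm
  let H : (Fin d → ℝ) → ℂ := fun η => g (κ η) * wave (parabFreq (κ η)) z *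
    Complex.exp (((2 * Real.pi * ∑ i, n i * η i : ℝ) : ℂ) * Complex.I)
  have hHc : Continuous H := by
    have h1 : Continuous fun η => wave (parabFreq (κ η)) z :=
      (continuous_wave_left z).comp (continuous_parabFreq.comp κ.continuous)
    refine ((hg.comp κ.continuous).mul h1).mul ?_
    fun_prop
  have hHs : HasCompactSupport H :=
    ((hgc.comp_homeomorph κ.toHomeomorph).mul_right).mul_right
  have h1 : freeWave g (z + (period b n, 0)) = (c : ℂ) * ∫ η, H η := by
    rw [freeWave, hc, integral_smul_nnreal_measure,
      show Measure.map κ volume = Measure.map κ.toHomeomorph.toMeasurableEquiv volume from rfl,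
      integral_map_equiv]
    rw [NNReal.smul_def, Complex.real_smul]
    refine congrArg (((c : ℝ) : ℂ) * ·)
      (integral_congr_ae (Filter.Eventually.of_forall fun η => ?_))
    change g (κ η) * wave (parabFreq (κ η)) (z + (period b n, 0)) = H η
    rw [wave_add_period]
    have : dualCoord b (parabFreq (κ η)).1 = η := (dualCoord b).apply_symm_apply η
    rw [this]
    simp only [H]
    ring
  rw [h1, integral_eq_sum_unitCube (hHc.integrable_of_hasCompactSupport hHs) K]
  · congr 1
    have h2 : ∀ m ∈ K, IntegrableOn (fun s => H (s + intVec m)) (unitCube d) := fun m _ =>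
      integrableOn_unitCube (hHc.comp (continuous_id.add continuous_const))
    rw [← integral_finsetSum _ h2]
    refine integral_congr_ae (Filter.Eventually.of_forall fun s => ?_)
    beta_reduce
    rw [fibreWave, Finset.mul_sum]
    refine Finset.sum_congr rfl fun m _ => ?_
    have h3 : Complex.exp (((2 * Real.pi * ∑ i, n i * (s + intVec m) i : ℝ) : ℂ) * Complex.I) =
        Complex.exp (((2 * Real.pi * ∑ i, n i * s i : ℝ) : ℂ) * Complex.I) := by
      rw [Complex.exp_eq_exp_iff_exists_int]
      refine ⟨∑ i, n i * m i, ?_⟩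
      simp only [Pi.add_apply, intVec, mul_add, Finset.sum_add_distrib]
      push_cast
      ring
    simp only [H, h3]
    ring
  · intro m hm s hs
    simp only [H, κ, hK m hm s hs, zero_mul]

theorem exists_finset_cubes (b : Module.Basis (Fin d) ℝ (Space d)) (hgc : HasCompactSupport g) :
    ∃ K : Finset (Fin d → ℤ), ∀ n ∉ K, ∀ s ∈ unitCube d,
      g ((dualCoord b).symm (s + intVec n)) = 0 := by
  obtain ⟨R, hR⟩ := hgc.isCompact.isBounded.exists_norm_le
  set E := (dualCoord b : Space d →L[ℝ] (Fin d → ℝ))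
  have hfin := finite_norm_intVec_le (d := d) (‖E‖ * R + 1)
  refine ⟨hfin.toFinset, fun n hn s hs => ?_⟩
  by_contra h0
  refine hn ((Set.Finite.mem_toFinset hfin).2 ?_)
  have h1 := hR _ (subset_tsupport g h0)
  have h2 := E.le_opNorm ((dualCoord b).symm (s + intVec n))
  have h3 : E ((dualCoord b).symm (s + intVec n)) = s + intVec n :=
    (dualCoord b).apply_symm_apply _
  rw [h3] at h2
  have h4 : ‖s‖ ≤ 1 := by
    refine (pi_norm_le_iff_of_nonneg zero_le_one).2 fun i => ?_
    have := unitCube_subset hs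
    rw [Real.norm_of_nonneg (this.1 i)]
    exact this.2 i
  have h5 : ‖intVec n‖ ≤ ‖s + intVec n‖ + ‖s‖ := by
    simpa using norm_sub_le (s + intVec n) s
  have h6 : ‖E‖ * ‖(dualCoord b).symm (s + intVec n)‖ ≤ ‖E‖ * R := by gcongr
  rw [Set.mem_ofPred_eq]
  linarith

/-- Lebesgue integrals over the frequency space, fibre by fibre. -/
theorem lintegral_enorm_sq_eq_fibres (hg : Continuous g)
    (hK : ∀ n ∉ K, ∀ s ∈ unitCube d, g ((dualCoord b).symm (s + intVec n)) = 0) {c : NNReal}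
    (hc : (volume : Measure (Space d)) = c • Measure.map (dualCoord b).symm volume) :
    ∫⁻ ξ, ‖g ξ‖ₑ ^ 2 = c * ∫⁻ s in unitCube d,
      ∑ n ∈ K, ‖g ((dualCoord b).symm (s + intVec n))‖ₑ ^ 2 := by
  have hm : ∀ n, Measurable fun s => ‖g ((dualCoord b).symm (s + intVec n))‖ₑ ^ 2 := by
    intro n
    have : Continuous fun s => g ((dualCoord b).symm (s + intVec n)) :=
      hg.comp ((dualCoord b).symm.continuous.comp (continuous_id.add continuous_const))
    exact this.enorm.measurable.pow_const 2
  rw [hc, lintegral_smul_measure, ENNReal.smul_def, smul_eq_mul,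
    show Measure.map (dualCoord b).symm volume =
      Measure.map (dualCoord b).symm.toHomeomorph.toMeasurableEquiv volume from rfl,
    lintegral_map_equiv, lintegral_finsetSum _ fun n _ => hm n]
  congr 1
  refine lintegral_eq_sum_unitCube (fun s => ‖g ((dualCoord b).symm s)‖ₑ ^ 2) K
    fun n hn s hs => ?_
  beta_reduce
  rw [hK n hn s hs, enorm_zero, zero_pow two_ne_zero]

/-- Parseval's identity along the periods. -/
theorem lintegral_fibreWave_eq_tsum (hg : Continuous g) (hgc : HasCompactSupport g)
    (hK : ∀ n ∉ K, ∀ s ∈ unitCube d, g ((dualCoord b).symm (s + intVec n)) = 0) {c : NNReal}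
    (hc : (volume : Measure (Space d)) = c • Measure.map (dualCoord b).symm volume)
    (z : SpaceTime d) :
    (c : ENNReal) ^ 2 * ∫⁻ s in unitCube d, ‖fibreWave b g K s z‖ₑ ^ 2 =
      ∑' n, ‖freeWave g (z + (period b n, 0))‖ₑ ^ 2 := by
  have hW : Continuous fun s => fibreWave b g K s z :=
    Continuous.comp (g := fun p : (Fin d → ℝ) × SpaceTime d => fibreWave b g K p.1 p.2)
      (f := fun s => (s, z)) (continuous_fibreWave b K hg) (continuous_id.prodMk continuous_const)
  rw [← tsum_enorm_integral_unitCube_sq hW, ← ENNReal.tsum_mul_left]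
  refine tsum_congr fun n => ?_
  rw [freeWave_add_period hg hgc hK hc, enorm_mul, mul_pow]
  congr 2
  rw [← ofReal_norm]
  simp

end Floquet

theorem continuous_freeWave {g : Space d → ℂ} (hg : Integrable g) : Continuous (freeWave g) := by
  refine continuous_of_dominated (bound := fun ξ => ‖g ξ‖)
    (F := fun z ξ => g ξ * wave (parabFreq ξ) z) ?_ ?_ hg.norm ?_
  · intro z
    have h : Continuous fun ξ : Space d => wave (parabFreq ξ) z :=
      (continuous_wave_left z).comp continuous_parabFreq
    exact hg.aestronglyMeasurable.mul h.aestronglyMeasurable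
  · intro z
    filter_upwards with ξ
    rw [norm_mul, norm_wave, mul_one]
  · filter_upwards with ξ
    exact (continuous_wave_right (parabFreq ξ)).const_mul (g ξ)

/-- Disjoint translates by periods of a ball inside a periodic cylinder. -/
theorem tsum_lintegral_ball_add_period_le {S : Set (Space d)} {I : Set ℝ}
    {b : Module.Basis (Fin d) ℝ (Space d)}
    (hb : ∀ (i : Fin d) (x : Space d), x + b i ∈ S ↔ x ∈ S) {z₀ : SpaceTime d} {r : ℝ}
    (hball : Metric.ball z₀ r ⊆ S ×ˢ I) (hr : ∀ n : Fin d → ℤ, n ≠ 0 → 2 * r ≤ ‖period b n‖)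
    (F : SpaceTime d → ENNReal) :
    ∑' n, ∫⁻ z in Metric.ball z₀ r, F (z + (period b n, 0)) ≤ ∫⁻ z in S ×ˢ I, F z := by
  have hadd : ∀ m n, period b (m - n) = period b m - period b n := fun m n => by
    simp only [period, Pi.sub_apply, sub_smul, Finset.sum_sub_distrib]
  have h1 : ∀ n, ∫⁻ z in Metric.ball z₀ r, F (z + (period b n, 0)) =
      ∫⁻ z in Metric.ball (z₀ + (period b n, 0)) r, F z := by
    intro n
    rw [← lintegral_indicator measurableSet_ball, ← lintegral_indicator measurableSet_ball,
      ← lintegral_add_right_eq_self (Set.indicator _ F) ((period b n, 0) : SpaceTime d)]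
    refine lintegral_congr fun z => ?_
    have h2 : z + (period b n, 0) ∈ Metric.ball (z₀ + (period b n, 0)) r ↔
        z ∈ Metric.ball z₀ r := by
      rw [Metric.mem_ball, dist_add_right, Metric.mem_ball]
    by_cases hz : z ∈ Metric.ball z₀ r
    · rw [Set.indicator_of_mem hz, Set.indicator_of_mem (h2.2 hz)]
    · rw [Set.indicator_of_notMem hz, Set.indicator_of_notMem (mt h2.1 hz)]
  simp_rw [h1]
  rw [← lintegral_iUnion fun n => measurableSet_ball]
  · refine lintegral_mono_set (Set.iUnion_subset fun n z hz => ?_)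
    have h2 : z - (period b n, 0) ∈ Metric.ball z₀ r := by
      rw [mem_ball_iff_norm] at hz ⊢
      rwa [sub_right_comm, sub_sub, add_comm] at *
    have h3 := hball h2
    refine ⟨?_, by simpa using h3.2⟩
    rw [← sub_add_cancel z.1 (period b n)]
    exact (add_period_mem_iff hb n _).2 h3.1
  · intro m n hmn
    refine Metric.ball_disjoint_ball ?_
    rw [dist_add_left, dist_eq_norm, ← two_mul]
    refine (hr (m - n) (sub_ne_zero.2 hmn)).trans ?_
    rw [hadd]
    exact norm_fst_le ((period b m, (0 : ℝ)) - (period b n, 0))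

/-- **Observability inequality** for free waves with continuous compactly supported Fourier data. -/
theorem exists_lintegral_le_freeWave {S : Set (Space d)} (hne : S.Nonempty) (hopen : IsOpen S)
    (hper : IsPeriodicSet S) {T : ℝ} (hT : 0 < T) :
    ∃ C : ENNReal, C ≠ ⊤ ∧ ∀ g : Space d → ℂ, Continuous g → HasCompactSupport g →
      ∫⁻ ξ, ‖g ξ‖ₑ ^ 2 ≤ C * ∫⁻ z in S ×ˢ Set.Ioo (0 : ℝ) T, ‖freeWave g z‖ₑ ^ 2 := by
  obtain ⟨b, hb⟩ := hper
  obtain ⟨x₀, hx₀⟩ := hne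
  obtain ⟨δ, hδ0, hδ⟩ := exists_le_norm_period b
  obtain ⟨c, hc0, hc⟩ := exists_volume_eq_smul_map b
  obtain ⟨z₀, hz₀⟩ : (S ×ˢ Set.Ioo (0 : ℝ) T).Nonempty :=
    ⟨(x₀, T / 2), hx₀, by simpa using hT, by simpa using hT⟩
  obtain ⟨r₀, hr₀, hball₀⟩ := Metric.isOpen_iff.1 (hopen.prod isOpen_Ioo) z₀ hz₀
  -- a radius for which the ball stays in the control region and has disjoint translates
  obtain ⟨r, hr, hr1, hr2⟩ : ∃ r : ℝ, 0 < r ∧ r ≤ r₀ ∧ 2 * r ≤ δ :=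
    ⟨min r₀ (δ / 2), by positivity, min_le_left _ _, by linarith [min_le_right r₀ (δ / 2)]⟩
  have hball : Metric.ball z₀ r ⊆ S ×ˢ Set.Ioo (0 : ℝ) T :=
    (Metric.ball_subset_ball hr1).trans hball₀
  obtain ⟨C, hC0, hC⟩ := exists_sum_le_integral_fibreWave b hr z₀
  have hc' : (c : ENNReal) ≠ 0 := by exact_mod_cast hc0
  refine ⟨ENNReal.ofReal C * (c : ENNReal)⁻¹, ENNReal.mul_ne_top ENNReal.ofReal_ne_top
    (ENNReal.inv_ne_top.2 hc'), fun g hg hgc => ?_⟩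
  obtain ⟨K, hK⟩ := exists_finset_cubes b hgc
  have hW := continuous_fibreWave b K hg
  have hU := continuous_freeWave (hg.integrable_of_hasCompactSupport hgc)
  have h2 : ∀ s, ∑ n ∈ K, ‖g ((dualCoord b).symm (s + intVec n))‖ₑ ^ 2 ≤
      ENNReal.ofReal C * ∫⁻ z in Metric.ball z₀ r, ‖fibreWave b g K s z‖ₑ ^ 2 := by
    intro s
    have hWs : Continuous fun z => fibreWave b g K s z :=
      Continuous.comp (g := fun p : (Fin d → ℝ) × SpaceTime d => fibreWave b g K p.1 p.2)
        (f := fun z => (s, z)) hW (continuous_const.prodMk continuous_id)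
    have hW1 : Continuous fun z => ‖fibreWave b g K s z‖ ^ 2 := hWs.norm.pow 2
    simp_rw [enorm_sq_eq]
    rw [← ENNReal.ofReal_sum_of_nonneg fun n _ => sq_nonneg _,
      ← ofReal_integral_eq_lintegral_ofReal (integrableOn_ball_of_continuous hW1 _ _)
        (Filter.Eventually.of_forall fun z => sq_nonneg _), ← ENNReal.ofReal_mul hC0]
    exact ENNReal.ofReal_le_ofReal (hC g K s)
  have hm : ∀ n, Measurable fun z => ‖freeWave g (z + (period b n, 0))‖ₑ ^ 2 := fun n =>
    (hU.comp (continuous_id.add continuous_const)).enorm.measurable.pow_const 2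
  have hc2 : (c : ENNReal) ^ 2 ≠ ⊤ := ENNReal.pow_ne_top ENNReal.coe_ne_top
  have h5 : (c : ENNReal) ^ 2 *
      ∫⁻ s in unitCube d, ∫⁻ z in Metric.ball z₀ r, ‖fibreWave b g K s z‖ₑ ^ 2 =
      ∑' n, ∫⁻ z in Metric.ball z₀ r, ‖freeWave g (z + (period b n, 0))‖ₑ ^ 2 := by
    rw [← lintegral_tsum fun n => (hm n).aemeasurable]
    simp_rw [← lintegral_fibreWave_eq_tsum hg hgc hK hc]
    rw [lintegral_const_mul' _ _ hc2, lintegral_lintegral_swap]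
    exact (hW.enorm.measurable.pow_const 2).aemeasurable
  have h6 := tsum_lintegral_ball_add_period_le hb hball (fun n hn => hr2.trans (hδ n hn))
    fun z => ‖freeWave g z‖ₑ ^ 2
  rw [← h5] at h6
  have h7 : (c : ENNReal)⁻¹ * (c : ENNReal) ^ 2 = c := by
    rw [sq, ← mul_assoc, ENNReal.inv_mul_cancel hc' ENNReal.coe_ne_top, one_mul]
  set J := ∫⁻ s in unitCube d, ∫⁻ z in Metric.ball z₀ r, ‖fibreWave b g K s z‖ₑ ^ 2
  calc ∫⁻ ξ, ‖g ξ‖ₑ ^ 2 ≤ c * (ENNReal.ofReal C * J) := by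
        rw [lintegral_enorm_sq_eq_fibres hg hK hc, ← lintegral_const_mul' _ _ ENNReal.ofReal_ne_top]
        exact mul_le_mul_right (lintegral_mono h2) _
    _ = ENNReal.ofReal C * (c : ENNReal)⁻¹ * ((c : ENNReal) ^ 2 * J) := by
        rw [mul_assoc, ← mul_assoc _ ((c : ENNReal) ^ 2), h7, mul_left_comm]
    _ ≤ _ := mul_le_mul_right h6 _

/-! ### The free Schrödinger group -/

theorem eLpNorm_two_sq {α E : Type*} [MeasurableSpace α] [NormedAddCommGroup E] (f : α → E)
    (μ : Measure α) : eLpNorm f 2 μ ^ 2 = ∫⁻ x, ‖f x‖ₑ ^ 2 ∂μ := by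
  have := eLpNorm_nnreal_pow_eq_lintegral (f := f) (μ := μ) (p := 2) two_ne_zero
  simpa only [ENNReal.coe_ofNat, NNReal.coe_ofNat, ENNReal.rpow_ofNat] using this

theorem enorm_toLp_sq {α E : Type*} [MeasurableSpace α] [NormedAddCommGroup E] {μ : Measure α}
    {f : α → E} (hf : MemLp f 2 μ) : ‖hf.toLp f‖ₑ ^ 2 = ∫⁻ x, ‖f x‖ₑ ^ 2 ∂μ := by
  rw [Lp.enorm_toLp, eLpNorm_two_sq]

theorem enorm_Lp_sq {α E : Type*} [MeasurableSpace α] [NormedAddCommGroup E] {μ : Measure α}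
    (f : Lp E 2 μ) : ‖f‖ₑ ^ 2 = ∫⁻ x, ‖f x‖ₑ ^ 2 ∂μ := by
  rw [Lp.enorm_def, eLpNorm_two_sq]

theorem memLp_two_of_lintegral_ne_top {α E : Type*} [MeasurableSpace α] [NormedAddCommGroup E]
    {μ : Measure α} {f : α → E} (hf : AEStronglyMeasurable f μ)
    (h : ∫⁻ x, ‖f x‖ₑ ^ 2 ∂μ ≠ ⊤) : MemLp f 2 μ := by
  refine ⟨hf, lt_top_iff_ne_top.2 fun h' => h ?_⟩
  rw [← eLpNorm_two_sq, h', ENNReal.top_pow two_ne_zero]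

/-- Multiplication by the symbol of `exp (i t Δ)`, as an isometry of `L²`. -/
def symbolMul (t : ℝ) : L2 d →ₗᵢ[ℂ] L2 d where
  toFun v := (memLp_schrodingerSymbol_mul t v).toLp _
  map_add' v w := by
    rw [← MemLp.toLp_add, MemLp.toLp_eq_toLp_iff]
    filter_upwards [Lp.coeFn_add v w] with ξ h
    simp only [h, Pi.add_apply, mul_add]
  map_smul' c v := by
    rw [RingHom.id_apply, ← MemLp.toLp_const_smul, MemLp.toLp_eq_toLp_iff]
    filter_upwards [Lp.coeFn_smul c v] with ξ h
    simp only [h, Pi.smul_apply, smul_eq_mul, mul_left_comm]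
  norm_map' v := by
    have h : ‖(memLp_schrodingerSymbol_mul t v).toLp _‖ₑ ^ 2 = ‖v‖ₑ ^ 2 := by
      rw [enorm_toLp_sq, enorm_Lp_sq]
      refine lintegral_congr fun ξ => ?_
      rw [enorm_mul, ← ofReal_norm, norm_schrodingerSymbol, ENNReal.ofReal_one, one_mul]
    have h2 : ‖(memLp_schrodingerSymbol_mul t v).toLp _‖ₑ = ‖v‖ₑ :=
      (ENNReal.pow_right_strictMono two_ne_zero).injective h
    rw [← toReal_enorm, ← toReal_enorm]
    exact congrArg ENNReal.toReal h2

theorem coeFn_symbolMul (t : ℝ) (v : L2 d) :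
    symbolMul t v =ᵐ[volume] fun ξ => schrodingerSymbol t ξ * v ξ :=
  (memLp_schrodingerSymbol_mul t v).coeFn_toLp

theorem schrodingerSymbol_add (s t : ℝ) (ξ : Space d) :
    schrodingerSymbol (s + t) ξ = schrodingerSymbol s ξ * schrodingerSymbol t ξ := by
  simp only [schrodingerSymbol, ← Complex.exp_add]
  congr 1
  push_cast
  ring

theorem symbolMul_symbolMul (s t : ℝ) (v : L2 d) :
    symbolMul s (symbolMul t v) = symbolMul (s + t) v := by
  refine Lp.ext ?_
  filter_upwards [coeFn_symbolMul s (symbolMul t v), coeFn_symbolMul t v,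
    coeFn_symbolMul (s + t) v] with ξ h1 h2 h3
  rw [h1, h2, h3, schrodingerSymbol_add, mul_assoc]

theorem symbolMul_zero (v : L2 d) : symbolMul 0 v = v := by
  refine Lp.ext ?_
  filter_upwards [coeFn_symbolMul 0 v] with ξ h
  rw [h, schrodingerSymbol]
  simp

theorem continuous_symbolMul (v : L2 d) : Continuous fun t => symbolMul t v := by
  refine continuous_iff_continuousAt.2 fun t₀ => ?_
  rw [ContinuousAt, tendsto_iff_edist_tendsto_0]
  have h1 : ∀ t, edist (symbolMul t v) (symbolMul t₀ v) ^ 2 =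
      ∫⁻ ξ, ‖(schrodingerSymbol t ξ - schrodingerSymbol t₀ ξ) * v ξ‖ₑ ^ 2 := by
    intro t
    rw [edist_eq_enorm_sub, enorm_Lp_sq]
    refine lintegral_congr_ae ?_
    filter_upwards [Lp.coeFn_sub (symbolMul t v) (symbolMul t₀ v), coeFn_symbolMul t v,
      coeFn_symbolMul t₀ v] with ξ h1 h2 h3
    rw [h1, Pi.sub_apply, h2, h3, sub_mul]
  have h2 : Filter.Tendsto (fun t => edist (symbolMul t v) (symbolMul t₀ v) ^ 2) (nhds t₀)
      (nhds 0) := by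
    simp_rw [h1]
    have h3 := tendsto_lintegral_filter_of_dominated_convergence (μ := volume) (l := nhds t₀)
      (F := fun t ξ => ‖(schrodingerSymbol t ξ - schrodingerSymbol t₀ ξ) * v ξ‖ₑ ^ 2)
      (f := fun _ => 0) (fun ξ => 4 * ‖v ξ‖ₑ ^ 2) ?_ ?_ ?_ ?_
    · simpa only [lintegral_zero] using h3
    · filter_upwards with t
      have h4 : Continuous fun ξ : Space d => schrodingerSymbol t ξ - schrodingerSymbol t₀ ξ :=
        (continuous_schrodingerSymbol t).sub (continuous_schrodingerSymbol t₀)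
      exact (h4.measurable.mul (Lp.stronglyMeasurable v).measurable).enorm.pow_const 2
    · filter_upwards with t
      filter_upwards with ξ
      rw [enorm_mul, mul_pow]
      gcongr
      have h4 : ‖schrodingerSymbol t ξ - schrodingerSymbol t₀ ξ‖ₑ ≤ 2 := by
        rw [← ofReal_norm]
        have h5 := norm_sub_le (schrodingerSymbol t ξ) (schrodingerSymbol t₀ ξ)
        rw [norm_schrodingerSymbol, norm_schrodingerSymbol] at h5
        refine (ENNReal.ofReal_le_ofReal h5).trans (le_of_eq ?_)
        rw [one_add_one_eq_two]
        exact ENNReal.ofReal_ofNat 2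
      calc _ ≤ (2 : ENNReal) ^ 2 := pow_le_pow_left' h4 2
        _ = 4 := by norm_num
    · rw [lintegral_const_mul' _ _ (by finiteness), ← enorm_Lp_sq]
      finiteness
    · filter_upwards with ξ
      have h4 : Continuous fun t =>
          ‖(schrodingerSymbol t ξ - schrodingerSymbol t₀ ξ) * v ξ‖ₑ ^ 2 := by
        refine (ENNReal.continuous_pow 2).comp (Continuous.enorm ?_)
        unfold schrodingerSymbol
        fun_prop
      have h5 := h4.tendsto t₀
      simpa using h5
  have h3 := ((ENNReal.continuous_rpow_const (y := 1 / 2)).tendsto 0).comp h2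
  simp only [ENNReal.zero_rpow_of_pos (show (0 : ℝ) < 1 / 2 by norm_num)] at h3
  refine h3.congr fun t => ?_
  rw [Function.comp_apply, ← ENNReal.rpow_natCast, ← ENNReal.rpow_mul]
  norm_num

/-- The free Schrödinger group as a linear isometry. -/
def schrodingerIsometry (t : ℝ) : L2 d →ₗᵢ[ℂ] L2 d :=
  (Lp.fourierTransformₗᵢ (Space d) ℂ).symm.toLinearIsometry.comp
    ((symbolMul t).comp (Lp.fourierTransformₗᵢ (Space d) ℂ).toLinearIsometry)

theorem schrodingerIsometry_apply (t : ℝ) (u : L2 d) :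
    schrodingerIsometry t u = schrodingerGroup t u := rfl

theorem schrodingerGroup_eq (t : ℝ) (u : L2 d) :
    schrodingerGroup t u = 𝓕⁻ (symbolMul t (𝓕 u) : L2 d) := rfl

theorem schrodingerGroup_schrodingerGroup (s t : ℝ) (u : L2 d) :
    schrodingerGroup s (schrodingerGroup t u) = schrodingerGroup (s + t) u := by
  rw [schrodingerGroup_eq, schrodingerGroup_eq t, FourierTransform.fourier_fourierInv_eq,
    symbolMul_symbolMul, ← schrodingerGroup_eq]

theorem schrodingerGroup_zero (u : L2 d) : schrodingerGroup 0 u = u := by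
  rw [schrodingerGroup_eq, symbolMul_zero, FourierTransform.fourierInv_fourier_eq]

theorem inner_schrodingerGroup_neg (s : ℝ) (v w : L2 d) :
    inner ℂ v (schrodingerGroup (-s) w) = inner ℂ (schrodingerGroup s v) w := by
  have h := (schrodingerIsometry s).inner_map_map v (schrodingerGroup (-s) w)
  rw [schrodingerIsometry_apply, schrodingerIsometry_apply, schrodingerGroup_schrodingerGroup,
    add_neg_cancel, schrodingerGroup_zero] at h
  exact h.symm

theorem norm_schrodingerGroup (s : ℝ) (v : L2 d) : ‖schrodingerGroup s v‖ = ‖v‖ :=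
  (schrodingerIsometry s).norm_map v

/-- The group is jointly continuous, being strongly continuous and isometric. -/
theorem continuous_schrodingerGroup : Continuous fun p : L2 d × ℝ => schrodingerGroup p.2 p.1 := by
  refine continuous_prod_of_continuous_lipschitzWith _ 1 (fun v => ?_) fun t => ?_
  · exact (Lp.fourierTransformₗᵢ (Space d) ℂ).symm.continuous.comp (continuous_symbolMul (𝓕 v))
  · exact (schrodingerIsometry t).lipschitz

/-- For smooth compactly supported Fourier data the free evolution is given by `freeWave`. -/
theorem coeFn_schrodingerGroup_eq_freeWave {g : Space d → ℂ} (hg : ContDiff ℝ (⊤ : ℕ∞) g)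
    (hgc : HasCompactSupport g) {v : L2 d} (hv : ⇑(𝓕 v : L2 d) =ᵐ[volume] g) (s : ℝ) :
    schrodingerGroup s v =ᵐ[volume] fun x => freeWave g (x, s) := by
  have h1 : HasCompactSupport fun ξ => schrodingerSymbol s ξ * g ξ := hgc.mul_left
  have h2 : ContDiff ℝ (⊤ : ℕ∞) fun ξ : Space d => schrodingerSymbol s ξ * g ξ := by
    refine ContDiff.mul ?_ hg
    unfold schrodingerSymbol
    have h3 : ContDiff ℝ (⊤ : ℕ∞) fun ξ : Space d => s * (4 * Real.pi ^ 2 * ‖ξ‖ ^ 2) :=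
      contDiff_const.mul (contDiff_const.mul (contDiff_norm_sq ℝ))
    exact (contDiff_const.mul (Complex.ofRealCLM.contDiff.comp h3)).neg.cexp
  set F := h1.toSchwartzMap h2
  have h4 : symbolMul s (𝓕 v) = F.toLp 2 := by
    refine Lp.ext ?_
    filter_upwards [coeFn_symbolMul s (𝓕 v), F.coeFn_toLp 2, hv] with ξ h5 h6 h7
    rw [h5, h6, h7]
    rfl
  rw [schrodingerGroup_eq, h4, SchwartzMap.toLp_fourierInv_eq]
  filter_upwards [(𝓕⁻ F).coeFn_toLp 2] with x hx
  rw [hx, SchwartzMap.fourierInv_coe, Real.fourierInv_eq', freeWave]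
  refine integral_congr_ae (Filter.Eventually.of_forall fun ξ => ?_)
  change Complex.exp _ • (schrodingerSymbol s ξ * g ξ) = g ξ * wave (parabFreq ξ) (x, s)
  rw [smul_eq_mul, ← mul_assoc, mul_comm (g ξ), schrodingerSymbol, wave, ← Complex.exp_add]
  congr 2
  simp only [parabFreq]
  push_cast
  ring

/-! ### Time slices of controls -/

/-- In a separable metric space open sets are countable unions of balls. -/
theorem measurable_of_measurable_edist {α X : Type*} [MeasurableSpace α] [PseudoEMetricSpace X]
    [SecondCountableTopology X] [MeasurableSpace X] [BorelSpace X] {F : α → X}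
    (h : ∀ a, Measurable fun s => edist (F s) a) : Measurable F := by
  refine measurable_of_isOpen fun U hU => ?_
  have h1 : ∀ x ∈ U, ∃ ε > 0, Metric.eball x ε ⊆ U := EMetric.isOpen_iff.1 hU
  choose! r hr0 hrU using h1
  obtain ⟨T, hTU, hTc, hT⟩ := TopologicalSpace.isOpen_biUnion_countable U
    (fun x => Metric.eball x (r x)) fun x _ => Metric.isOpen_eball
  have h2 : U = ⋃ x ∈ T, Metric.eball x (r x) := by
    rw [hT]
    refine Set.Subset.antisymm (fun x hx => Set.mem_biUnion hx ?_) (Set.iUnion₂_subset hrU)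
    exact Metric.mem_eball_self (hr0 x hx)
  rw [h2, Set.preimage_iUnion₂]
  exact MeasurableSet.biUnion hTc fun x _ => measurableSet_lt (h x) measurable_const

variable {S : Set (Space d)} {T : ℝ}

theorem measurable_sliceIndicator (hS : MeasurableSet S) (f : Control S T) :
    Measurable fun p : Space d × ℝ => S.indicator (fun x => f (x, p.2)) p.1 := by
  have h : (fun p : Space d × ℝ => S.indicator (fun x => f (x, p.2)) p.1) =
      (S ×ˢ Set.univ).indicator f := by
    ext ⟨x, s⟩
    by_cases hx : x ∈ S
    · rw [Set.indicator_of_mem hx,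
        Set.indicator_of_mem (s := S ×ˢ Set.univ) (Set.mk_mem_prod hx (Set.mem_univ s))]
    · rw [Set.indicator_of_notMem hx,
        Set.indicator_of_notMem (s := S ×ˢ Set.univ) fun h => hx h.1]
  rw [h]
  exact (Lp.stronglyMeasurable f).measurable.indicator (hS.prod MeasurableSet.univ)

theorem lintegral_sliceIndicator (hS : MeasurableSet S) (f : Control S T) (s : ℝ) :
    ∫⁻ x, ‖S.indicator (fun x => f (x, s)) x‖ₑ ^ 2 = ∫⁻ x in S, ‖f (x, s)‖ₑ ^ 2 := by
  rw [← lintegral_indicator hS]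
  refine lintegral_congr fun x => ?_
  by_cases hx : x ∈ S
  · rw [Set.indicator_of_mem hx, Set.indicator_of_mem hx]
  · rw [Set.indicator_of_notMem hx, Set.indicator_of_notMem hx, enorm_zero, zero_pow two_ne_zero]

theorem aestronglyMeasurable_sliceIndicator (hS : MeasurableSet S) (f : Control S T) (s : ℝ) :
    AEStronglyMeasurable (S.indicator fun x => f (x, s)) volume :=
  ((measurable_sliceIndicator hS f).comp
    (measurable_id.prodMk (measurable_const (a := s)))).aestronglyMeasurable

theorem memLp_sliceIndicator_iff (hS : MeasurableSet S) (f : Control S T) (s : ℝ) :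
    MemLp (S.indicator fun x => f (x, s)) 2 volume ↔ ∫⁻ x in S, ‖f (x, s)‖ₑ ^ 2 ≠ ⊤ := by
  rw [← lintegral_sliceIndicator hS]
  refine ⟨fun h => ?_, memLp_two_of_lintegral_ne_top (aestronglyMeasurable_sliceIndicator hS f s)⟩
  rw [← eLpNorm_two_sq]
  exact ENNReal.pow_ne_top h.2.ne

theorem measurable_lintegral_slice (f : Control S T) :
    Measurable fun s => ∫⁻ x in S, ‖f (x, s)‖ₑ ^ 2 :=
  ((Lp.stronglyMeasurable f).measurable.enorm.pow_const 2).lintegral_prod_left'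

theorem lintegral_lintegral_slice (f : Control S T) :
    ∫⁻ s in Set.Ioo 0 T, ∫⁻ x in S, ‖f (x, s)‖ₑ ^ 2 = ‖f‖ₑ ^ 2 := by
  have h : (volume : Measure (Space d × ℝ)).restrict (S ×ˢ Set.Ioo 0 T) =
      ((volume : Measure (Space d)).restrict S).prod (volume.restrict (Set.Ioo 0 T)) := by
    rw [Measure.volume_eq_prod, Measure.prod_restrict]
  rw [enorm_Lp_sq]
  refine Eq.trans ?_ (congrArg (fun μ => ∫⁻ z, ‖f z‖ₑ ^ 2 ∂μ) h.symm)
  exact (lintegral_prod_symm _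
    ((Lp.stronglyMeasurable f).measurable.enorm.pow_const 2).aemeasurable).symm

theorem ae_memLp_slice (hS : MeasurableSet S) (f : Control S T) :
    ∀ᵐ s ∂volume.restrict (Set.Ioo 0 T), MemLp (S.indicator fun x => f (x, s)) 2 volume := by
  have h := ae_lt_top (measurable_lintegral_slice f)
    (by rw [lintegral_lintegral_slice f]; finiteness)
  filter_upwards [h] with s hs
  exact (memLp_sliceIndicator_iff hS f s).2 hs.ne

theorem enorm_controlSlice_sq (hS : MeasurableSet S) (f : Control S T) {s : ℝ}
    (h : MemLp (S.indicator fun x => f (x, s)) 2 volume) :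
    ‖controlSlice f s‖ₑ ^ 2 = ∫⁻ x in S, ‖f (x, s)‖ₑ ^ 2 := by
  rw [controlSlice, dif_pos h, enorm_toLp_sq, lintegral_sliceIndicator hS]

theorem coeFn_controlSlice (f : Control S T) {s : ℝ}
    (h : MemLp (S.indicator fun x => f (x, s)) 2 volume) :
    controlSlice f s =ᵐ[volume] S.indicator fun x => f (x, s) := by
  rw [controlSlice, dif_pos h]
  exact h.coeFn_toLp

/-- Slicing is measurable into the separable space `L²`, because by Tonelli's theorem the distances
of the slices to a fixed function are measurable. -/
theorem stronglyMeasurable_controlSlice (hS : MeasurableSet S) (f : Control S T) :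
    StronglyMeasurable (controlSlice f) := by
  classical
  have : Fact ((2 : ENNReal) ≠ ⊤) := ⟨ENNReal.ofNat_ne_top⟩
  borelize (L2 d)
  refine Measurable.stronglyMeasurable (measurable_of_measurable_edist fun a => ?_)
  have h1 : ∀ s, edist (controlSlice f s) a ^ 2 = if ∫⁻ x in S, ‖f (x, s)‖ₑ ^ 2 ≠ ⊤ then
      ∫⁻ x, ‖S.indicator (fun x => f (x, s)) x - a x‖ₑ ^ 2 else ‖a‖ₑ ^ 2 := by
    intro s
    split_ifs with h
    · have h2 := (memLp_sliceIndicator_iff hS f s).2 h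
      rw [edist_eq_enorm_sub, enorm_Lp_sq]
      refine lintegral_congr_ae ?_
      filter_upwards [Lp.coeFn_sub (controlSlice f s) a, coeFn_controlSlice f h2] with x h3 h4
      rw [h3, Pi.sub_apply, h4]
    · rw [controlSlice, dif_neg (mt (memLp_sliceIndicator_iff hS f s).1 h), edist_comm,
        edist_zero_right]
  have h2 : Measurable fun s => edist (controlSlice f s) a ^ 2 := by
    simp_rw [h1]
    refine Measurable.ite ?_ ?_ measurable_const
    · exact (measurable_lintegral_slice f (measurableSet_singleton ⊤)).compl
    · have h3 : Measurable fun p : Space d × ℝ =>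
          ‖S.indicator (fun x => f (x, p.2)) p.1 - a p.1‖ₑ ^ 2 :=
        ((measurable_sliceIndicator hS f).sub
          ((Lp.stronglyMeasurable a).measurable.comp measurable_fst)).enorm.pow_const 2
      exact h3.lintegral_prod_left'
  have h3 : ∀ x : ENNReal, (x ^ 2) ^ (1 / 2 : ℝ) = x := by
    intro x
    rw [← ENNReal.rpow_ofNat, ← ENNReal.rpow_mul, mul_one_div_cancel two_ne_zero,
      ENNReal.rpow_one]
  simpa only [h3] using h2.pow_const (1 / 2 : ℝ)

/-- Slicing identifies `L²(S × (0,T))` isometrically with a subspace of `L²(0,T; L²)`. -/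
theorem eLpNorm_controlSlice (hS : MeasurableSet S) (f : Control S T) :
    eLpNorm (controlSlice f) 2 (volume.restrict (Set.Ioo 0 T)) = ‖f‖ₑ := by
  refine (ENNReal.pow_right_strictMono two_ne_zero).injective ?_
  beta_reduce
  rw [eLpNorm_two_sq, ← lintegral_lintegral_slice f]
  refine lintegral_congr_ae ?_
  filter_upwards [ae_memLp_slice hS f] with s hs
  exact enorm_controlSlice_sq hS f hs

/-- Fubini's theorem for null sets: almost every time slice of an almost everywhere equality holds
almost everywhere. -/
theorem ae_slice_congr {f g : Space d × ℝ → ℂ}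
    (h : f =ᵐ[volume.restrict (S ×ˢ Set.Ioo (0 : ℝ) T)] g) :
    ∀ᵐ s ∂volume.restrict (Set.Ioo 0 T), ∀ᵐ x ∂volume.restrict S, f (x, s) = g (x, s) := by
  rw [Measure.volume_eq_prod, ← Measure.prod_restrict] at h
  have h1 := (Measure.measurePreserving_swap (μ := volume.restrict (Set.Ioo (0 : ℝ) T))
    (ν := (volume : Measure (Space d)).restrict S)).quasiMeasurePreserving.ae h
  exact Measure.ae_ae_of_ae_prod h1

theorem controlSlice_ae_eq (hS : MeasurableSet S) (f : Control S T) {h : Space d × ℝ → ℂ}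
    (hfh : f =ᵐ[volume.restrict (S ×ˢ Set.Ioo (0 : ℝ) T)] h) :
    ∀ᵐ s ∂volume.restrict (Set.Ioo 0 T),
      controlSlice f s =ᵐ[volume] S.indicator fun x => h (x, s) := by
  filter_upwards [ae_memLp_slice hS f, ae_slice_congr hfh] with s h1 h2
  refine (coeFn_controlSlice f h1).trans ?_
  rw [ae_restrict_iff' hS] at h2
  filter_upwards [h2] with x hx
  by_cases hxS : x ∈ S
  · rw [Set.indicator_of_mem hxS, Set.indicator_of_mem hxS, hx hxS]
  · rw [Set.indicator_of_notMem hxS, Set.indicator_of_notMem hxS]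

theorem controlSlice_add (hS : MeasurableSet S) (f g : Control S T) :
    ∀ᵐ s ∂volume.restrict (Set.Ioo 0 T),
      controlSlice (f + g) s = controlSlice f s + controlSlice g s := by
  filter_upwards [controlSlice_ae_eq hS (f + g) (Lp.coeFn_add f g), ae_memLp_slice hS f,
    ae_memLp_slice hS g] with s h1 h2 h3
  refine Lp.ext ?_
  filter_upwards [h1, Lp.coeFn_add (controlSlice f s) (controlSlice g s),
    coeFn_controlSlice f h2, coeFn_controlSlice g h3] with x k1 k2 k3 k4
  rw [k1, k2, Pi.add_apply, k3, k4]
  exact congrFun (Set.indicator_add S (fun x => f (x, s)) fun x => g (x, s)) x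

theorem controlSlice_smul (hS : MeasurableSet S) (c : ℂ) (f : Control S T) :
    ∀ᵐ s ∂volume.restrict (Set.Ioo 0 T), controlSlice (c • f) s = c • controlSlice f s := by
  filter_upwards [controlSlice_ae_eq hS (c • f) (Lp.coeFn_smul c f), ae_memLp_slice hS f]
    with s h1 h2
  refine Lp.ext ?_
  filter_upwards [h1, Lp.coeFn_smul c (controlSlice f s), coeFn_controlSlice f h2] with x k1 k2 k3
  rw [k1, k2, Pi.smul_apply, k3]
  exact Set.indicator_const_smul_apply S c (fun x => f (x, s)) x

/-! ### The control-to-state map -/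

theorem memLp_schrodingerGroup_controlSlice (hS : MeasurableSet S) (f : Control S T) (t : ℝ) :
    MemLp (fun s => schrodingerGroup (t - s) (controlSlice f s)) 2
      (volume.restrict (Set.Ioo 0 T)) := by
  have h1 : StronglyMeasurable fun s => (controlSlice f s, t - s) :=
    (stronglyMeasurable_controlSlice hS f).prodMk
      (continuous_const.sub continuous_id).stronglyMeasurable
  refine ⟨(continuous_schrodingerGroup.comp_stronglyMeasurable h1).aestronglyMeasurable, ?_⟩
  rw [eLpNorm_congr_norm_ae (g := controlSlice f)
    (Filter.Eventually.of_forall fun s => norm_schrodingerGroup _ _), eLpNorm_controlSlice hS]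
  finiteness

theorem integrableOn_schrodingerGroup_controlSlice (hS : MeasurableSet S) (f : Control S T)
    (t : ℝ) :
    IntegrableOn (fun s => schrodingerGroup (t - s) (controlSlice f s)) (Set.Ioc 0 T) := by
  rw [integrableOn_Ioc_iff_integrableOn_Ioo]
  exact (memLp_schrodingerGroup_controlSlice hS f t).integrable (by norm_num)

theorem intervalIntegrable_schrodingerGroup_controlSlice (hS : MeasurableSet S) (f : Control S T)
    (r : ℝ) {t : ℝ} (ht : t ∈ Set.Icc (0 : ℝ) T) :
    IntervalIntegrable (fun s => schrodingerGroup (r - s) (controlSlice f s)) volume 0 t := by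
  rw [intervalIntegrable_iff_integrableOn_Ioc_of_le ht.1]
  exact (integrableOn_schrodingerGroup_controlSlice hS f r).mono_set
    (Set.Ioc_subset_Ioc_right ht.2)

/-- The map sending a control `f` to `∫₀ᵀ exp (-i s Δ) 1_S f(s) ds`. Up to a unitary factor it is
the final state reached from zero. -/
def controlMap (hS : MeasurableSet S) (T : ℝ) : Control S T →L[ℂ] L2 d :=
  LinearMap.mkContinuous
    { toFun := fun f => ∫ s in Set.Ioo 0 T, schrodingerGroup (0 - s) (controlSlice f s)
      map_add' := by
        intro f g
        rw [← integral_add ((memLp_schrodingerGroup_controlSlice hS f 0).integrable (by norm_num))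
          ((memLp_schrodingerGroup_controlSlice hS g 0).integrable (by norm_num))]
        refine integral_congr_ae ?_
        filter_upwards [controlSlice_add hS f g] with s hs
        rw [hs]
        exact map_add (schrodingerIsometry (0 - s)) _ _
      map_smul' := by
        intro c f
        rw [RingHom.id_apply, ← integral_smul]
        refine integral_congr_ae ?_
        filter_upwards [controlSlice_smul hS c f] with s hs
        rw [hs]
        exact map_smul (schrodingerIsometry (0 - s)) _ _ }
    ((volume.restrict (Set.Ioo 0 T) Set.univ) ^ (1 / 2 : ℝ)).toReal
    (by
      intro f
      have h1 := memLp_schrodingerGroup_controlSlice hS f 0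
      have h2 : ‖∫ s in Set.Ioo 0 T, schrodingerGroup (0 - s) (controlSlice f s)‖ₑ ≤
          ‖f‖ₑ * (volume.restrict (Set.Ioo 0 T) Set.univ) ^ (1 / 2 : ℝ) := by
        refine (enorm_integral_le_lintegral_enorm _).trans ?_
        rw [← eLpNorm_one_eq_lintegral_enorm]
        refine (eLpNorm_le_eLpNorm_mul_rpow_measure_univ (p := 1) (q := 2) (by norm_num)
          h1.1).trans (le_of_eq ?_)
        rw [eLpNorm_congr_norm_ae (g := controlSlice f)
          (Filter.Eventually.of_forall fun s => norm_schrodingerGroup _ _),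
          eLpNorm_controlSlice hS]
        norm_num
      have h3 : ‖f‖ₑ * (volume.restrict (Set.Ioo 0 T) Set.univ) ^ (1 / 2 : ℝ) ≠ ⊤ := by
        refine ENNReal.mul_ne_top enorm_ne_top (ENNReal.rpow_ne_top_of_nonneg (by norm_num) ?_)
        exact measure_ne_top _ _
      have h4 := ENNReal.toReal_mono h3 h2
      rw [ENNReal.toReal_mul, toReal_enorm, toReal_enorm, mul_comm] at h4
      exact h4)

theorem controlMap_apply (hS : MeasurableSet S) (f : Control S T) :
    controlMap hS T f = ∫ s in Set.Ioo 0 T, schrodingerGroup (0 - s) (controlSlice f s) := rfl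

/-! ### Observability and exact controllability -/

variable {S : Set (Space d)} {T : ℝ}

/-- The free evolution of a smooth datum is square integrable in space-time over a bounded time
interval, as the `L²` norm is conserved. -/
theorem memLp_freeWave {g : Space d → ℂ} (hg : ContDiff ℝ (⊤ : ℕ∞) g)
    (hgc : HasCompactSupport g) {v : L2 d} (hv : ⇑(𝓕 v : L2 d) =ᵐ[volume] g) :
    MemLp (freeWave g) 2 (volume.restrict (S ×ˢ Set.Ioo (0 : ℝ) T)) := by
  have hc := continuous_freeWave (hg.continuous.integrable_of_hasCompactSupport hgc)
  refine memLp_two_of_lintegral_ne_top hc.aestronglyMeasurable ?_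
  have h : (volume : Measure (Space d × ℝ)).restrict (S ×ˢ Set.Ioo 0 T) =
      ((volume : Measure (Space d)).restrict S).prod (volume.restrict (Set.Ioo 0 T)) := by
    rw [Measure.volume_eq_prod, Measure.prod_restrict]
  rw [h, lintegral_prod_symm _ (hc.measurable.enorm.pow_const 2).aemeasurable]
  refine ne_top_of_le_ne_top (b := ∫⁻ _ in Set.Ioo (0 : ℝ) T, ‖v‖ₑ ^ 2) ?_
    (lintegral_mono fun s => ?_)
  · rw [setLIntegral_const]
    exact ENNReal.mul_ne_top (by finiteness) (by simp)
  · calc ∫⁻ x in S, ‖freeWave g (x, s)‖ₑ ^ 2 ≤ ∫⁻ x, ‖freeWave g (x, s)‖ₑ ^ 2 :=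
          setLIntegral_le_lintegral _ _
      _ = ∫⁻ x, ‖schrodingerGroup s v x‖ₑ ^ 2 := by
          refine lintegral_congr_ae ?_
          filter_upwards [coeFn_schrodingerGroup_eq_freeWave hg hgc hv s] with x hx
          rw [hx]
      _ = ‖schrodingerGroup s v‖ₑ ^ 2 := (enorm_Lp_sq _).symm
      _ = ‖v‖ₑ ^ 2 := by
          rw [← ofReal_norm, norm_schrodingerGroup, ofReal_norm]

/-- Pairing `v` with the image of a control is pairing the free evolution of `v` with the control,
slice by slice. -/
theorem inner_controlMap (hS : MeasurableSet S) (v : L2 d) (f : Control S T) :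
    inner ℂ v (controlMap hS T f) =
      ∫ s in Set.Ioo 0 T, inner ℂ (schrodingerGroup s v) (controlSlice f s) := by
  rw [controlMap_apply, ← integral_inner
    ((memLp_schrodingerGroup_controlSlice hS f 0).integrable (by norm_num))]
  simp only [zero_sub, inner_schrodingerGroup_neg]

/-- If the control is the restriction of the free evolution of `v`, then its pairing with the
evolution of `v` is its squared norm. -/
theorem inner_controlMap_freeWave (hS : MeasurableSet S) {g : Space d → ℂ}
    (hg : ContDiff ℝ (⊤ : ℕ∞) g) (hgc : HasCompactSupport g) {v : L2 d}
    (hv : ⇑(𝓕 v : L2 d) =ᵐ[volume] g) :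
    inner ℂ v (controlMap hS T ((memLp_freeWave (S := S) (T := T) hg hgc hv).toLp _)) =
      ((‖(memLp_freeWave (S := S) (T := T) hg hgc hv).toLp _‖ ^ 2 : ℝ) : ℂ) := by
  set f : Control S T := (memLp_freeWave hg hgc hv).toLp _ with hf
  have hfg : f =ᵐ[volume.restrict (S ×ˢ Set.Ioo (0 : ℝ) T)] freeWave g :=
    (memLp_freeWave hg hgc hv).coeFn_toLp
  have h1 : inner ℂ v (controlMap hS T f) =
      ∫ s in Set.Ioo 0 T, ((‖controlSlice f s‖ ^ 2 : ℝ) : ℂ) := by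
    rw [inner_controlMap]
    refine integral_congr_ae ?_
    filter_upwards [controlSlice_ae_eq hS f hfg] with s hs
    have h4 : ((‖controlSlice f s‖ ^ 2 : ℝ) : ℂ) =
        inner ℂ (controlSlice f s) (controlSlice f s) := by
      rw [Complex.ofReal_pow]
      exact (inner_self_eq_norm_sq_to_K (𝕜 := ℂ) (controlSlice f s)).symm
    rw [h4, L2.inner_def, L2.inner_def]
    refine integral_congr_ae ?_
    filter_upwards [hs, coeFn_schrodingerGroup_eq_freeWave hg hgc hv s] with x h2 h3
    rw [h2, h3]
    by_cases hx : x ∈ S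
    · rw [Set.indicator_of_mem hx]
    · rw [Set.indicator_of_notMem hx, inner_zero_right, inner_zero_right]
  rw [h1, integral_complex_ofReal]
  congr 1
  rw [integral_eq_lintegral_of_nonneg_ae (Filter.Eventually.of_forall fun s => sq_nonneg _)
    ((stronglyMeasurable_controlSlice hS f).norm.pow 2).aestronglyMeasurable,
    ← toReal_enorm, ← ENNReal.toReal_pow, ← eLpNorm_controlSlice hS f, eLpNorm_two_sq]
  simp only [ENNReal.ofReal_pow (norm_nonneg _), ofReal_norm]

/-- Observability: the initial datum is bounded by its image under the adjoint of the
control-to-state map. It suffices to prove this for the dense set of data with smooth compactly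
supported Fourier transforms. -/
theorem exists_norm_le_adjoint_controlMap (hne : S.Nonempty) (hopen : IsOpen S)
    (hper : IsPeriodicSet S) (hT : 0 < T) :
    ∃ c : NNReal, 0 < c ∧ ∀ v : L2 d,
      ‖v‖ ≤ c * ‖(controlMap hopen.measurableSet T).adjoint v‖ := by
  obtain ⟨C, hC, h⟩ := exists_lintegral_le_freeWave hne hopen hper hT
  set Ψ := controlMap hopen.measurableSet T with hΨ
  set c : NNReal := (C ^ (1 / 2 : ℝ)).toNNReal + 1 with hc
  have hcC : C ≤ (c : ENNReal) ^ 2 := by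
    have h1 : C ^ (1 / 2 : ℝ) ≤ c := by
      rw [hc, ENNReal.coe_add, ENNReal.coe_toNNReal
        (ENNReal.rpow_ne_top_of_nonneg (by norm_num) hC)]
      exact le_self_add
    calc C = (C ^ (1 / 2 : ℝ)) ^ 2 := by
          rw [← ENNReal.rpow_ofNat, ← ENNReal.rpow_mul, one_div_mul_cancel two_ne_zero,
            ENNReal.rpow_one]
      _ ≤ _ := by gcongr
  refine ⟨c, by positivity, fun v => ?_⟩
  have hclosed : IsClosed {w : L2 d | ‖(𝓕⁻ w : L2 d)‖ ≤ c * ‖Ψ.adjoint (𝓕⁻ w : L2 d)‖} := by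
    have h1 : Continuous fun w : L2 d => (𝓕⁻ w : L2 d) :=
      (Lp.fourierTransformₗᵢ (Space d) ℂ).symm.continuous
    exact isClosed_le h1.norm (continuous_const.mul (Ψ.adjoint.continuous.comp h1).norm)
  have hdense := Lp.dense_hasCompactSupport_contDiff (E := Space d) (F := ℂ) (p := 2)
    (μ := volume) (by norm_num)
  have hall : ∀ w : L2 d, ‖(𝓕⁻ w : L2 d)‖ ≤ c * ‖Ψ.adjoint (𝓕⁻ w : L2 d)‖ := by
    intro w
    refine hclosed.closure_subset_iff.2 ?_ (hdense w)
    rintro w ⟨g, hwg, hgc, hg⟩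
    change ‖(𝓕⁻ w : L2 d)‖ ≤ _
    set v : L2 d := 𝓕⁻ w with hv
    have hFv : (𝓕 v : L2 d) = w := FourierTransform.fourier_fourierInv_eq w
    have hvg : ⇑(𝓕 v : L2 d) =ᵐ[volume] g := by rw [hFv]; exact hwg
    have h1 := inner_controlMap_freeWave (T := T) hopen.measurableSet hg hgc hvg
    set f : Control S T := (memLp_freeWave hg hgc hvg).toLp _ with hf
    -- the restriction `f` of the free wave is no larger than `Ψ.adjoint v`, by pairing them
    have h2 : ‖f‖ ^ 2 ≤ ‖Ψ.adjoint v‖ * ‖f‖ := by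
      have h3 := norm_inner_le_norm (𝕜 := ℂ) (Ψ.adjoint v) f
      rw [ContinuousLinearMap.adjoint_inner_left, h1, Complex.norm_real, norm_pow, norm_norm] at h3
      exact h3
    have h3 : ‖f‖ ≤ ‖Ψ.adjoint v‖ := by
      rcases (norm_nonneg f).eq_or_lt with h4 | h4
      · rw [← h4]; exact norm_nonneg _
      · exact le_of_mul_le_mul_right (by rwa [← sq]) h4
    have h4 : ‖v‖ₑ ^ 2 ≤ ((c : ENNReal) * ‖f‖ₑ) ^ 2 := by
      have h5 : ‖v‖ₑ = ‖w‖ₑ := by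
        rw [← ofReal_norm, ← ofReal_norm]
        exact congrArg _ ((Lp.fourierTransformₗᵢ (Space d) ℂ).symm.norm_map w)
      calc ‖v‖ₑ ^ 2 = ∫⁻ ξ, ‖g ξ‖ₑ ^ 2 := by
            rw [h5, enorm_Lp_sq]
            refine lintegral_congr_ae ?_
            filter_upwards [hwg] with ξ hξ
            rw [hξ]
        _ ≤ C * ∫⁻ z in S ×ˢ Set.Ioo 0 T, ‖freeWave g z‖ₑ ^ 2 := h g hg.continuous hgc
        _ = C * ‖f‖ₑ ^ 2 := by rw [hf, enorm_toLp_sq]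
        _ ≤ (c : ENNReal) ^ 2 * ‖f‖ₑ ^ 2 := by gcongr
        _ = _ := (mul_pow _ _ _).symm
    have h5 : ‖v‖ₑ ≤ (c : ENNReal) * ‖f‖ₑ := (ENNReal.pow_le_pow_left_iff two_ne_zero).1 h4
    have h6 : ‖v‖ ≤ c * ‖f‖ := by
      have h7 := ENNReal.toReal_mono (by finiteness) h5
      rwa [ENNReal.toReal_mul, toReal_enorm, toReal_enorm, ENNReal.coe_toReal] at h7
    exact h6.trans (by gcongr)
  have := hall (𝓕 v : L2 d)
  rwa [FourierTransform.fourierInv_fourier_eq v] at this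

/-- By the observability estimate `Ψ Ψ†` is coercive, where `Ψ` is the control-to-state map. -/
theorem surjective_controlMap (hne : S.Nonempty) (hopen : IsOpen S)
    (hper : IsPeriodicSet S) (hT : 0 < T) :
    Function.Surjective (controlMap hopen.measurableSet T) := by
  obtain ⟨c, hc, h⟩ := exists_norm_le_adjoint_controlMap hne hopen hper hT
  set Ψ := controlMap hopen.measurableSet T with hΨ
  have hu : IsUnit (Ψ ∘L Ψ.adjoint) := by
    refine ContinuousLinearMap.isUnit_of_forall_le_norm_inner_map _ (c := (c ^ 2)⁻¹)
      (by positivity) fun v => ?_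
    rw [ContinuousLinearMap.comp_apply, ← ContinuousLinearMap.adjoint_inner_right,
      inner_self_eq_norm_sq_to_K, norm_pow, RCLike.norm_ofReal, abs_norm, NNReal.coe_inv,
      NNReal.coe_pow, ← div_eq_mul_inv, div_le_iff₀ (by positivity), ← mul_pow, mul_comm]
    gcongr
    exact h v
  intro w
  obtain ⟨v, hv⟩ := (ContinuousLinearMap.isUnit_iff_bijective.1 hu).2 w
  exact ⟨Ψ.adjoint v, hv⟩

/-- By linearity and reversibility, controllability means reaching every state from zero. -/
theorem controllable_of_surjective_controlMap (hS : MeasurableSet S) (hT : 0 < T)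
    (h : Function.Surjective (controlMap hS T)) : Controllable S T := by
  intro u₀ u₁
  obtain ⟨f, hf⟩ := h (schrodingerGroup (-T) (Complex.I • (u₁ - schrodingerGroup T u₀)))
  refine ⟨f, fun t => schrodingerGroup t u₀
      - Complex.I • ∫ s in (0 : ℝ)..t, schrodingerGroup (t - s) (controlSlice f s),
    ⟨fun t ht => intervalIntegrable_schrodingerGroup_controlSlice hS f t ht, fun t _ => rfl⟩, ?_⟩
  have h1 : ∫ s in (0 : ℝ)..T, schrodingerGroup (T - s) (controlSlice f s) =
      Complex.I • (u₁ - schrodingerGroup T u₀) := by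
    calc ∫ s in (0 : ℝ)..T, schrodingerGroup (T - s) (controlSlice f s)
        = ∫ s in Set.Ioo 0 T, (schrodingerIsometry T).toContinuousLinearMap
            (schrodingerGroup (0 - s) (controlSlice f s)) := by
          rw [intervalIntegral.integral_of_le hT.le, integral_Ioc_eq_integral_Ioo]
          refine integral_congr_ae (Filter.Eventually.of_forall fun s => ?_)
          change _ = schrodingerIsometry T _
          rw [schrodingerIsometry_apply, schrodingerGroup_schrodingerGroup, zero_sub,
            ← sub_eq_add_neg]
      _ = (schrodingerIsometry T).toContinuousLinearMap (controlMap hS T f) :=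
          ContinuousLinearMap.integral_comp_comm _
            ((memLp_schrodingerGroup_controlSlice hS f 0).integrable (by norm_num))
      _ = Complex.I • (u₁ - schrodingerGroup T u₀) := by
          change schrodingerIsometry T _ = _
          rw [schrodingerIsometry_apply, hf, schrodingerGroup_schrodingerGroup, add_neg_cancel,
            schrodingerGroup_zero]
  change schrodingerGroup T u₀
    - Complex.I • ∫ s in (0 : ℝ)..T, schrodingerGroup (T - s) (controlSlice f s) = u₁
  rw [h1, smul_smul, Complex.I_mul_I, neg_one_smul, sub_neg_eq_add, add_sub_cancel]

theorem Controllable.nullControllable (h : Controllable S T) : NullControllable S T :=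
  fun u₀ => h u₀ 0

end SchrodingerControl

end

theorem mainTheorem1 (d : ℕ) (S : Set (SchrodingerControl.Space d)) (hne : S.Nonempty)
    (hopen : IsOpen S) (hper : SchrodingerControl.IsPeriodicSet S) (T : ℝ) (hT : 0 < T) :
    SchrodingerControl.Controllable S T ∧ SchrodingerControl.NullControllable S T := by
  have h := SchrodingerControl.controllable_of_surjective_controlMap hopen.measurableSet hT
    (SchrodingerControl.surjective_controlMap hne hopen hper hT)
  exact ⟨h, h.nullControllable⟩
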